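/- Let $(K,v)$ be a henselian valued field, that is, $v$ has a unique extension (up to equivalence) to an algebraic closure of $K$. Let $\Lambda$ be a totally ordered abelian group such that $v$ takes values in $\Lambda\cup\{\infty\}$; a valuation on $K[x]$ means a $\Lambda\cup\{\infty\}$-valued valuation extending $v$, possibly with nontrivial support $\operatorname{supp}(\mu)=\mu^{-1}(\infty)$. We write $\mu<\eta$ if $\mu\ne\eta$ and $\mu(f)\le\eta(f)$ for all $f\in K[x]$. **Graded algebra, key polynomials, degrees.** For a valuation $\mu$ on $K[x]$ let $\Gamma_\mu$ be its value group, $\mathcal G_\mu=\bigoplus_{\alpha\in\Gamma_\mu}\{f:\mu(f)\ge\alpha\}/\{f:\mu(f)>\alpha\}$ its graded algebra, and $\operatorname{in}_\mu f\in\mathcal G_\mu$ the class of $f$ in degree $\mu(f)$ (for $f\notin\operatorname{supp}(\mu)$; put $\operatorname{in}_\mu f=0$ for $f\in\operatorname{supp}(\mu)$). A monic $\phi\notin\operatorname{supp}(\mu)$ is a *key polynomial* for $\mu$, $\phi\in\mathrm{KP}(\mu)$, if $\operatorname{in}_\mu\phi$ is not a unit, $\operatorname{in}_\mu\phi\mid\operatorname{in}_\mu(fg)$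 implies $\operatorname{in}_\mu\phi\mid\operatorname{in}_\mu f$ or $\operatorname{in}_\mu\phi\mid\operatorname{in}_\mu g$, and $\operatorname{in}_\mu\phi\mid\operatorname{in}_\mu f$ with $f\neq0$ implies $\deg\phi\le\deg f$. The degree $\deg(\mu)$ is the least degree of a key polynomial if $\mathrm{KP}(\mu)\ne\emptyset$, and the degree of a generator of $\operatorname{supp}(\mu)$ if $\operatorname{supp}(\mu)\neq0$ (in which case $\mathrm{KP}(\mu)=\emptyset$). If $\mathrm{KP}(\mu)\ne\emptyset$, then $\deg_\mu(f)$ is the degree of $\operatorname{in}_\mu f$ as a polynomial in $\operatorname{in}_\mu\phi$ with coefficients in the subalgebra of $\mathcal G_\mu$ generated by the homogeneous units, where $\phi$ is a key polynomial of minimal degree for $\mu$. **Augmentations.** The notation $\mu\to\nu$ means one of the following. * *Ordinary augmentation*: $\nu=[\mu;\phi,\gamma]$ with $\phi\in\mathrm{KP}(\mu)$, $\gamma\in\Lambda\cup\{\infty\}$, $\gamma>\mu(\phi)$; that is, $\nu(\sum_i a_i\phi^i)=\min_i\{\mu(a_i)+i\gamma\}$ whenever $\deg a_i<\deg\phi$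 for all $i$. * *Limit augmentation*: $\nu=[\mathcal C;\phi,\gamma]$, where $\mathcal C=(\rho_i)_{i\in A}$ is a family of valuations on $K[x]$ indexed by a nonempty well-ordered set $A$ without last element, $\rho_i<\rho_j$ for $i<j$, $\deg(\rho_i)$ is eventually constant, and $\rho_{\min A}=\mu$; $\phi$ is a monic polynomial of least degree among the polynomials $f$ for which $\rho_i(f)$ is not eventually constant; $\gamma\in\Lambda\cup\{\infty\}$ satisfies $\gamma>\rho_i(\phi)$ for all $i$; and $\nu(\sum_i a_i\phi^i)=\min_i\{\rho_{\mathcal C}(a_i)+i\gamma\}$ whenever $\deg a_i<\deg\phi$ for all $i$, where $\rho_{\mathcal C}(a)$ is the eventual value of $\rho_i(a)$. The family $\mathcal C$ is *based on* $\mu$ if $\deg(\rho_i)=\deg(\mu)$ for all large $i$. **Defect.** For $\mu\to\nu$ let $\mathbf t(\mu,\nu)$ be the set of monic polynomials $Q$ of minimal degree satisfying $\mu(Q)<\nu(Q)$, and $\deg\mathbf t(\mu,\nu)$ the common degree of its elements. Let $\phi$ be a key polynomial of minimal degree of $\nu$, or the monic generator of $\operatorname{supp}(\nu)$ if this is not zero.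 The *defect* is $$d(\mu\to\nu)=\min\{\deg_{\rho_Q}(\phi)\mid Q\in\mathbf t(\mu,\nu)\},\qquad \rho_Q=[\mu;Q,\nu(Q)],$$ where $\deg_{\rho_Q}(\phi)$ is read as $1$ if $\phi\in\operatorname{supp}(\rho_Q)$ (this happens only if $Q=\phi$ and $\nu(\phi)=\infty$). **Statement.** For every augmentation $\mu\to\nu$ the defect $d(\mu\to\nu)$ exists, does not depend on the choice of $\phi$, and $$d(\mu\to\nu)=\frac{\deg(\nu)}{\deg\mathbf t(\mu,\nu)}.$$ In particular, if $\mu\to\nu$ is a limit augmentation with respect to a continuous family based on $\mu$, then $$d(\mu\to\nu)=\frac{\deg(\nu)}{\deg(\mu)}.$$ -/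

import Mathlib

open Polynomial
open scoped DirectSum

universe u w z

noncomputable section

namespace MLV

/-! Valuations are written additively, with values in `Λ ∪ {∞} = WithTop Λ`. -/

section Henselian

variable {K Λ : Type*} [Field K] [AddCommGroup Λ] [LinearOrder Λ] [IsOrderedAddMonoid Λ]

/-- `(K, v)` is henselian: `v` has a unique extension to the algebraic closure of `K`. An extension
(up to equivalence) is recorded by its valuation ring, a valuation ring of the algebraic closure
whose intersection with `K` is the valuation ring of `v`. -/
def IsHenselian (v : AddValuation K (WithTop Λ)) : Prop :=
  ∃! O : ValuationSubring (AlgebraicClosure K),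
    ∀ a : K, algebraMap K (AlgebraicClosure K) a ∈ O ↔ 0 ≤ v a

/-- `μ` is an extension of `v` to `K[x]`. -/
def Extends (v : AddValuation K (WithTop Λ)) (μ : AddValuation K[X] (WithTop Λ)) : Prop :=
  ∀ a : K, μ (C a) = v a

end Henselian

section Graded

variable {K Λ : Type*} [Field K] [AddCommGroup Λ] [LinearOrder Λ] [IsOrderedAddMonoid Λ]
variable (μ : AddValuation K[X] (WithTop Λ))

/-- The value group `Γ_μ`: the subgroup generated by the values of the polynomials that are not in
the support. -/
def valueGroup : AddSubgroup Λ :=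
  AddSubgroup.closure {a : Λ | ∃ f : K[X], μ f = (a : WithTop Λ)}

/-- `P_α = {f | μ f ≥ α}`. -/
def levelGE (α : valueGroup μ) : AddSubgroup K[X] where
  carrier := {f | ((α : Λ) : WithTop Λ) ≤ μ f}
  zero_mem' := by simp
  add_mem' := fun ha hb => μ.map_le_add ha hb
  neg_mem' := fun {f} hf => by
    simpa [AddValuation.map_neg] using hf

/-- `P_α⁺ = {f | μ f > α}`. -/
def levelGT (α : valueGroup μ) : AddSubgroup K[X] where
  carrier := {f | ((α : Λ) : WithTop Λ) < μ f}
  zero_mem' := by simp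
  add_mem' := fun ha hb => μ.map_lt_add ha hb
  neg_mem' := fun {f} hf => by
    simpa [AddValuation.map_neg] using hf

/-- The homogeneous component `P_α / P_α⁺`. -/
abbrev GradedPiece (α : valueGroup μ) : Type _ :=
  levelGE μ α ⧸ (levelGT μ α).addSubgroupOf (levelGE μ α)

variable {μ}

/-- The class of `f ∈ P_α` in `P_α / P_α⁺`. -/
def pieceMk (α : valueGroup μ) (f : levelGE μ α) : GradedPiece μ α :=
  QuotientAddGroup.mk f

theorem pieceMk_eq_iff {α : valueGroup μ} {f g : levelGE μ α} :
    pieceMk α f = pieceMk α g ↔ ((α : Λ) : WithTop Λ) < μ ((f : K[X]) - g) := by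
  unfold pieceMk
  rw [QuotientAddGroup.eq, AddSubgroup.mem_addSubgroupOf]
  change ((α : Λ) : WithTop Λ) < μ (-(f : K[X]) + g) ↔ _
  rw [μ.map_sub_swap, neg_add_eq_sub]

theorem graded_mk_eq {α β : valueGroup μ} (h : α = β) {f : levelGE μ α} {g : levelGE μ β}
    (hfg : (f : K[X]) = g) :
    GradedMonoid.mk (A := GradedPiece μ) α (pieceMk α f) = GradedMonoid.mk β (pieceMk β g) := by
  subst h
  have : f = g := Subtype.ext hfg
  rw [this]

theorem mul_mem_levelGE {α β : valueGroup μ} (f : levelGE μ α) (g : levelGE μ β) :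
    (f : K[X]) * g ∈ levelGE μ (α + β) := by
  change (((α + β : valueGroup μ) : Λ) : WithTop Λ) ≤ μ ((f : K[X]) * g)
  rw [AddValuation.map_mul, AddSubgroup.coe_add, WithTop.coe_add]
  exact add_le_add f.2 g.2

/-- Multiplication `P_α / P_α⁺ × P_β / P_β⁺ → P_{α+β} / P_{α+β}⁺`, induced by the product of
polynomials. -/
def pieceMul {α β : valueGroup μ} (a : GradedPiece μ α) (b : GradedPiece μ β) :
    GradedPiece μ (α + β) :=
  Quotient.liftOn₂' a b (fun f g => pieceMk (α + β) ⟨(f : K[X]) * g, mul_mem_levelGE f g⟩) (by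
    intro f g f' g' hf hg
    have h1 : ((α : Λ) : WithTop Λ) < μ ((f : K[X]) - f') :=
      pieceMk_eq_iff.1 (Quotient.sound hf)
    have h2 : ((β : Λ) : WithTop Λ) < μ ((g : K[X]) - g') :=
      pieceMk_eq_iff.1 (Quotient.sound hg)
    refine pieceMk_eq_iff.2 ?_
    have e : (f : K[X]) * g - (f' : K[X]) * g' = ((f : K[X]) - f') * g + f' * ((g : K[X]) - g') := by
      ring
    change (((α + β : valueGroup μ) : Λ) : WithTop Λ) < μ ((f : K[X]) * g - (f' : K[X]) * g')
    rw [e, AddSubgroup.coe_add, WithTop.coe_add]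
    refine μ.map_lt_add ?_ ?_
    · rw [AddValuation.map_mul]
      exact WithTop.add_lt_add_of_lt_of_le WithTop.coe_ne_top h1 g.2
    · rw [AddValuation.map_mul]
      exact WithTop.add_lt_add_of_le_of_lt WithTop.coe_ne_top f'.2 h2)

theorem pieceMul_mk {α β : valueGroup μ} (f : levelGE μ α) (g : levelGE μ β) :
    pieceMul (pieceMk α f) (pieceMk β g) =
      pieceMk (α + β) ⟨(f : K[X]) * g, mul_mem_levelGE f g⟩ := rfl

theorem one_mem_levelGE : (1 : K[X]) ∈ levelGE μ 0 := by
  change (((0 : valueGroup μ) : Λ) : WithTop Λ) ≤ μ 1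
  rw [AddValuation.map_one]
  simp

theorem pieceMk_surjective {α : valueGroup μ} (a : GradedPiece μ α) : ∃ f, pieceMk α f = a :=
  QuotientAddGroup.mk_surjective a

theorem pieceMk_add {α : valueGroup μ} (f g : levelGE μ α) :
    pieceMk α (f + g) = pieceMk α f + pieceMk α g := rfl

instance : GradedMonoid.GMul (GradedPiece μ) where
  mul := pieceMul

instance : GradedMonoid.GOne (GradedPiece μ) where
  one := pieceMk 0 ⟨1, one_mem_levelGE⟩

theorem graded_one_mul (a : GradedMonoid (GradedPiece μ)) : 1 * a = a := by
  obtain ⟨α, a⟩ := a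
  obtain ⟨f, rfl⟩ := pieceMk_surjective a
  exact graded_mk_eq (zero_add α) (one_mul _)

theorem graded_mul_one (a : GradedMonoid (GradedPiece μ)) : a * 1 = a := by
  obtain ⟨α, a⟩ := a
  obtain ⟨f, rfl⟩ := pieceMk_surjective a
  exact graded_mk_eq (add_zero α) (mul_one _)

theorem graded_mul_assoc (a b c : GradedMonoid (GradedPiece μ)) : a * b * c = a * (b * c) := by
  obtain ⟨α, a⟩ := a
  obtain ⟨β, b⟩ := b
  obtain ⟨γ, c⟩ := c
  obtain ⟨f, rfl⟩ := pieceMk_surjective a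
  obtain ⟨g, rfl⟩ := pieceMk_surjective b
  obtain ⟨h, rfl⟩ := pieceMk_surjective c
  exact graded_mk_eq (add_assoc α β γ) (mul_assoc _ _ _)

theorem graded_mul_comm (a b : GradedMonoid (GradedPiece μ)) : a * b = b * a := by
  obtain ⟨α, a⟩ := a
  obtain ⟨β, b⟩ := b
  obtain ⟨f, rfl⟩ := pieceMk_surjective a
  obtain ⟨g, rfl⟩ := pieceMk_surjective b
  exact graded_mk_eq (add_comm α β) (mul_comm _ _)

theorem pieceMul_add {α β : valueGroup μ} (a : GradedPiece μ α) (b c : GradedPiece μ β) :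
    pieceMul a (b + c) = pieceMul a b + pieceMul a c := by
  obtain ⟨f, rfl⟩ := pieceMk_surjective a
  obtain ⟨g, rfl⟩ := pieceMk_surjective b
  obtain ⟨h, rfl⟩ := pieceMk_surjective c
  rw [← pieceMk_add, pieceMul_mk, pieceMul_mk, pieceMul_mk, ← pieceMk_add]
  congr 1
  exact Subtype.ext (mul_add _ _ _)

theorem add_pieceMul {α β : valueGroup μ} (a b : GradedPiece μ α) (c : GradedPiece μ β) :
    pieceMul (a + b) c = pieceMul a c + pieceMul b c := by
  obtain ⟨f, rfl⟩ := pieceMk_surjective a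
  obtain ⟨g, rfl⟩ := pieceMk_surjective b
  obtain ⟨h, rfl⟩ := pieceMk_surjective c
  rw [← pieceMk_add, pieceMul_mk, pieceMul_mk, pieceMul_mk, ← pieceMk_add]
  congr 1
  exact Subtype.ext (add_mul _ _ _)

instance : DirectSum.GCommRing (GradedPiece μ) where
  mul_zero := fun {α β} a => by
    have h := pieceMul_add a (0 : GradedPiece μ β) 0
    rw [add_zero] at h
    exact left_eq_add.1 h
  zero_mul := fun {α β} b => by
    have h := add_pieceMul (0 : GradedPiece μ α) 0 b
    rw [add_zero] at h
    exact left_eq_add.1 h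
  mul_add := pieceMul_add
  add_mul := add_pieceMul
  one_mul := graded_one_mul
  mul_one := graded_mul_one
  mul_assoc := graded_mul_assoc
  mul_comm := graded_mul_comm
  natCast := fun n => n • pieceMk 0 ⟨1, one_mem_levelGE⟩
  natCast_zero := zero_nsmul _
  natCast_succ := fun n => succ_nsmul _ n
  intCast := fun n => n • pieceMk 0 ⟨1, one_mem_levelGE⟩
  intCast_ofNat := fun n => natCast_zsmul _ n
  intCast_negSucc_ofNat := fun n => negSucc_zsmul _ n

variable (μ)

/-- The graded algebra `𝒢_μ = ⨁_{α ∈ Γ_μ} P_α / P_α⁺`, a commutative ring. -/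
abbrev GradedAlgebra : Type _ := ⨁ α : valueGroup μ, GradedPiece μ α

theorem untop_mem_valueGroup (f : K[X]) (h : μ f ≠ ⊤) : (μ f).untop h ∈ valueGroup μ :=
  AddSubgroup.subset_closure ⟨f, (WithTop.coe_untop _ h).symm⟩

open Classical in
/-- The initial form `in_μ f ∈ P_{μ(f)} / P_{μ(f)}⁺ ⊂ 𝒢_μ` of `f ∉ supp μ`; it is `0` for
`f ∈ supp μ`. -/
def initialForm (f : K[X]) : GradedAlgebra μ :=
  if h : μ f = ⊤ then 0
  else DirectSum.of (GradedPiece μ) ⟨(μ f).untop h, untop_mem_valueGroup μ f h⟩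
    (pieceMk _ ⟨f, (WithTop.coe_untop (μ f) h).le⟩)

/-- `𝒢_μ⁰`: the subalgebra of `𝒢_μ` generated by the homogeneous units. -/
def unitSubalgebra : Subring (GradedAlgebra μ) :=
  Subring.closure {u | IsUnit u ∧ ∃ (α : valueGroup μ) (a : GradedPiece μ α),
    u = DirectSum.of (GradedPiece μ) α a}

end Graded

section KeyPolynomials

variable {K Λ : Type*} [Field K] [AddCommGroup Λ] [LinearOrder Λ] [IsOrderedAddMonoid Λ]

/-- Mac Lane--Vaquié key polynomials: monic polynomials `φ` whose initial form is a nonzero nonunit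
such that `φ` is `μ`-irreducible and `μ`-minimal. -/
structure IsKeyPolynomial (μ : AddValuation K[X] (WithTop Λ)) (φ : K[X]) : Prop where
  monic : φ.Monic
  not_mem_supp : μ φ ≠ ⊤
  not_isUnit : ¬ IsUnit (initialForm μ φ)
  irreducible : ∀ f g : K[X], initialForm μ φ ∣ initialForm μ (f * g) →
    initialForm μ φ ∣ initialForm μ f ∨ initialForm μ φ ∣ initialForm μ g
  minimal : ∀ f : K[X], f ≠ 0 → initialForm μ φ ∣ initialForm μ f → φ.natDegree ≤ f.natDegree

/-- `φ` is a key polynomial of minimal degree for `μ`. -/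
def IsMinimalKeyPolynomial (μ : AddValuation K[X] (WithTop Λ)) (φ : K[X]) : Prop :=
  IsKeyPolynomial μ φ ∧ ∀ ψ, IsKeyPolynomial μ ψ → φ.natDegree ≤ ψ.natDegree

/-- `φ` is the monic generator of the support of `μ`, and the support is not trivial. -/
def IsSupportGenerator (μ : AddValuation K[X] (WithTop Λ)) (φ : K[X]) : Prop :=
  φ.Monic ∧ Irreducible φ ∧ μ.supp = Ideal.span {φ}

/-- `deg(μ)`: the minimal degree of a key polynomial if there are any, and the degree of a generator
of the support if the support is not trivial. The two cases exclude each other, and in each of them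
the set below has just one element. -/
def valDegree (μ : AddValuation K[X] (WithTop Λ)) : ℕ :=
  sInf {n | ∃ φ : K[X], (IsMinimalKeyPolynomial μ φ ∨ IsSupportGenerator μ φ) ∧ φ.natDegree = n}

/-- `deg_μ(f)` for `f ∉ supp μ`: the degree of `in_μ f` as a polynomial in `in_μ φ` with
coefficients in `𝒢_μ⁰`, where `φ` is a key polynomial of minimal degree. (As `in_μ φ` is
transcendental over `𝒢_μ⁰`, the set below has just one element.) If `μ` has no key polynomials,
the set is empty and the value is `0`. -/
def muDegree (μ : AddValuation K[X] (WithTop Λ)) (f : K[X]) : ℕ :=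
  sInf {n | ∃ φ : K[X], IsMinimalKeyPolynomial μ φ ∧ ∃ p : (unitSubalgebra μ)[X],
    aeval (initialForm μ φ) p = initialForm μ f ∧ p.natDegree = n}

/-- The tangent direction `t(μ, η)`: the monic polynomials `φ` of minimal degree with
`μ φ < η φ`. -/
def tangent (μ η : AddValuation K[X] (WithTop Λ)) : Set K[X] :=
  {φ | φ.Monic ∧ μ φ < η φ ∧ ∀ ψ : K[X], ψ.Monic → μ ψ < η ψ → φ.natDegree ≤ ψ.natDegree}

/-- `deg t(μ, η)`: the common degree of the elements of the tangent direction. -/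
def tangentDegree (μ η : AddValuation K[X] (WithTop Λ)) : ℕ :=
  sInf (natDegree '' tangent μ η)

end KeyPolynomials

section Augmentations

variable {K Λ : Type*} [Field K] [AddCommGroup Λ] [LinearOrder Λ] [IsOrderedAddMonoid Λ]

/-- `ν` acts on `φ`-expansions by `ν (∑ aᵢ φ ^ i) = min (β aᵢ + i γ)`, where `deg aᵢ < deg φ`. -/
def ActsOnExpansions (β : K[X] → WithTop Λ) (φ : K[X]) (γ : WithTop Λ)
    (ν : AddValuation K[X] (WithTop Λ)) : Prop :=
  ∀ (n : ℕ) (a : ℕ → K[X]), (∀ i, (a i).degree < φ.degree) →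
    ν (∑ i ∈ Finset.range n, a i * φ ^ i) = (Finset.range n).inf fun i => β (a i) + i • γ

/-- `ν = [μ; φ, γ]` is the ordinary augmentation of `μ` by the key polynomial `φ` and
`γ > μ φ`. -/
def IsOrdinaryAugmentation (μ : AddValuation K[X] (WithTop Λ)) (φ : K[X]) (γ : WithTop Λ)
    (ν : AddValuation K[X] (WithTop Λ)) : Prop :=
  IsKeyPolynomial μ φ ∧ μ φ < γ ∧ ActsOnExpansions μ φ γ ν

section Limit

variable {A : Type*} [LinearOrder A]

/-- A continuous family: `i ↦ ρ i` is an isomorphism of totally ordered sets onto its image, and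
`deg(ρ i)` is eventually constant. (The index set is a nonempty well-ordered set without last
element wherever this is used.) -/
structure IsContinuousFamily (ρ : A → AddValuation K[X] (WithTop Λ)) : Prop where
  le_of_lt : ∀ i j, i < j → ∀ f, ρ i f ≤ ρ j f
  ne_of_lt : ∀ i j, i < j → ρ i ≠ ρ j
  stable_degree : ∃ i₀, ∀ i, i₀ ≤ i → valDegree (ρ i) = valDegree (ρ i₀)

/-- The family is based on its initial valuation: the stable degree of the family is the degree of
its first member. -/
def IsBased [OrderBot A] (ρ : A → AddValuation K[X] (WithTop Λ)) : Prop :=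
  ∃ i₀, ∀ i, i₀ ≤ i → valDegree (ρ i) = valDegree (ρ ⊥)

/-- `f` is stable with respect to the family. -/
def IsStable (ρ : A → AddValuation K[X] (WithTop Λ)) (f : K[X]) : Prop :=
  ∃ i₀, ∀ i, i₀ ≤ i → ρ i f = ρ i₀ f

open Classical in
/-- The stable value `ρ_𝒞(f)` of a stable polynomial (and `∞` for unstable ones). -/
def stableValue (ρ : A → AddValuation K[X] (WithTop Λ)) (f : K[X]) : WithTop Λ :=
  if h : IsStable ρ f then ρ h.choose f else ⊤

/-- `φ` is a limit key polynomial: monic, unstable, and of least degree among the unstable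
polynomials. -/
def IsLimitKeyPolynomial (ρ : A → AddValuation K[X] (WithTop Λ)) (φ : K[X]) : Prop :=
  φ.Monic ∧ ¬ IsStable ρ φ ∧ ∀ ψ : K[X], ¬ IsStable ρ ψ → φ.natDegree ≤ ψ.natDegree

/-- `ν = [𝒞; φ, γ]` is the limit augmentation of the continuous family `𝒞 = (ρ i)` by the limit key
polynomial `φ` and `γ > ρ i φ` for all `i`. -/
def IsLimitAugmentation (ρ : A → AddValuation K[X] (WithTop Λ)) (φ : K[X]) (γ : WithTop Λ)
    (ν : AddValuation K[X] (WithTop Λ)) : Prop :=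
  IsContinuousFamily ρ ∧ IsLimitKeyPolynomial ρ φ ∧ (∀ i, ρ i φ < γ) ∧
    ActsOnExpansions (stableValue ρ) φ γ ν

end Limit

/-- `μ → ν`: either `ν = [μ; φ, γ]` is an ordinary augmentation of `μ`, or `ν = [𝒞; φ, γ]` is a limit
augmentation of a continuous family `𝒞` whose first member is `μ`. -/
def IsAugmentation {K : Type u} {Λ : Type w} [Field K] [AddCommGroup Λ]
    [LinearOrder Λ] [IsOrderedAddMonoid Λ] (μ ν : AddValuation K[X] (WithTop Λ)) : Prop :=
  (∃ φ γ, IsOrdinaryAugmentation μ φ γ ν) ∨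
  ∃ (A : Type z) (_ : LinearOrder A) (_ : WellFoundedLT A) (_ : OrderBot A) (_ : NoMaxOrder A)
    (ρ : A → AddValuation K[X] (WithTop Λ)) (φ : K[X]) (γ : WithTop Λ),
    ρ ⊥ = μ ∧ IsLimitAugmentation ρ φ γ ν

open Classical in
/-- The degrees `deg_{ρ_Q}(φ)` for `Q ∈ t(μ, ν)`, where `ρ_Q = [μ; Q, ν(Q)]`. If `φ ∈ supp ρ_Q`, then
`ν(Q) = ∞`, `Q = φ` and `ρ_Q = [μ; φ, ∞]`; in this case `deg_{ρ_Q}(φ)` is `1`, the degree of `φ`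
with respect to every `[μ; φ, γ]` with `γ < ∞`. -/
def defectDegrees (μ ν : AddValuation K[X] (WithTop Λ)) (φ : K[X]) : Set ℕ :=
  {n | ∃ Q ∈ tangent μ ν, ∃ ρ : AddValuation K[X] (WithTop Λ),
    IsOrdinaryAugmentation μ Q (ν Q) ρ ∧ n = if ρ φ = ⊤ then 1 else muDegree ρ φ}

/-- `d` is the defect `d(μ → ν)`: the minimum of the degrees `deg_{ρ_Q}(φ)`, `Q ∈ t(μ, ν)`, for
`φ` a key polynomial of minimal degree of `ν` or the generator of the support of `ν`, whatever the
choice of `φ`. -/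
def IsDefect (μ ν : AddValuation K[X] (WithTop Λ)) (d : ℕ) : Prop :=
  (∃ φ, IsMinimalKeyPolynomial ν φ ∨ IsSupportGenerator ν φ) ∧
  ∀ φ, IsMinimalKeyPolynomial ν φ ∨ IsSupportGenerator ν φ → IsLeast (defectDegrees μ ν φ) d

/-- The defect is unique. -/
theorem IsDefect.unique {μ ν : AddValuation K[X] (WithTop Λ)} {d d' : ℕ} (h : IsDefect μ ν d)
    (h' : IsDefect μ ν d') : d = d' := by
  obtain ⟨φ, hφ⟩ := h.1
  exact (h.2 φ hφ).unique (h'.2 φ hφ)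

end Augmentations

end MLV

end

/-! Fix Q in t(μ, ν), put γ = ν(Q) and ρ = [μ; Q, γ], and let φ be monic of least degree among the
polynomials whose ν-initial form is not a unit. By `isMinNonunit_iff` such φ are exactly the minimal
key polynomials and the support generators, so both cases of the definition of deg(ν) are treated at
once. The heart of the matter is that deg φ = s deg Q and ρ(φ) = s γ for some s
(`Separates.exists_natDegree_eq`). The degree of φ relative to ρ is then s = deg φ / deg Q for every
Q in the tangent direction, so the minimum defining the defect runs over a single value.

If γ = ∞, then φ = Q. Let γ be finite. Every monic f satisfies deg Q · ρ(f) ≤ deg f · γ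
(`HasRem.nsmul_val_le`). For f = φ the reverse inequality comes from henselianity: ν induces a
valuation w on K[x]/φ with w(Q) ≥ γ, all conjugates of the class of Q have the same value, and hence
its minimal polynomial χ has coefficients of value at least kγ in codegree k. Thus ρ(χ(Q)) ≥ deg χ ·
γ; since φ divides χ(Q), the upper bound for the cofactor yields deg Q · ρ(φ) ≥ deg φ · γ
(`nsmul_le_nsmul_val`). Equality leaves no room for a nonconstant leading coefficient c in the
Q-expansion of φ, because deg Q · μ(c) ≤ deg c · μ(Q) < deg c · γ.

To read s as a degree in the graded algebra, one needs that the components of elements of 𝒢_ρ⁰ are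
classes of polynomials of degree less than deg Q (`unitSubalgebra_apply`); this is proved by
lowering the value of Q infinitesimally.

The argument only needs μ < ν and a minimal nonunit for ν, which both kinds of augmentation supply.
For a family based on μ, deg t(μ, ν) = deg(μ). -/

noncomputable section

namespace MLV

/-! ### Units modulo higher value, minimal nonunits, and values of expansions. -/

section Arithmetic

variable {K Λ : Type*} [Field K] [AddCommGroup Λ] [LinearOrder Λ] [IsOrderedAddMonoid Λ]

theorem induction_divByMonic {Q : K[X]} (hQ : Q.Monic) (hd : 0 < Q.degree) {P : K[X] → Prop}
    (zero : P 0) (step : ∀ a q, a.degree < Q.degree → P q → P (a + Q * q)) (f : K[X]) : P f := by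
  induction hn : f.natDegree using Nat.strong_induction_on generalizing f with
  | _ n ih =>
    rw [← modByMonic_add_div f Q]
    refine step _ _ (degree_modByMonic_lt f hQ) ?_
    by_cases h0 : f /ₘ Q = 0
    · rwa [h0]
    · refine ih _ ?_ _ rfl
      have hle : Q.degree ≤ f.degree := by
        by_contra h
        exact h0 ((divByMonic_eq_zero_iff hQ).2 (not_le.1 h))
      have h1 := natDegree_divByMonic f hQ
      have h2 : 0 < Q.natDegree := natDegree_pos_iff_degree_pos.2 hd
      have h3 : Q.natDegree ≤ f.natDegree := natDegree_le_natDegree hle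
      omega

variable {μ ν ρ : AddValuation K[X] (WithTop Λ)} {Q φ : K[X]}

/-- `f` has an inverse up to terms of positive value: its initial form is a unit. -/
def InitUnit (ν : AddValuation K[X] (WithTop Λ)) (f : K[X]) : Prop :=
  ∃ g, 0 < ν (1 - f * g)

theorem val_eq_zero_of_pos {f : K[X]} (h : 0 < ν (1 - f)) : ν f = 0 := by
  have h1 : ν 1 < ν (f - 1) := by rwa [ν.map_one, ν.map_sub_swap]
  rw [ν.map_eq_of_lt_sub h1, ν.map_one]

theorem InitUnit.ne_top {f : K[X]} (h : InitUnit ν f) : ν f ≠ ⊤ := by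
  obtain ⟨g, hg⟩ := h
  intro hf
  have := val_eq_zero_of_pos hg
  simp [hf] at this

theorem InitUnit.of_lt {f g : K[X]} (h : InitUnit ν f) (hfg : ν f < ν (g - f)) :
    InitUnit ν g := by
  obtain ⟨c, hc⟩ := h
  have h0 := val_eq_zero_of_pos hc
  refine ⟨c, ?_⟩
  have e : 1 - g * c = (1 - f * c) - (g - f) * c := by ring
  rw [e, sub_eq_add_neg]
  refine ν.map_lt_add hc ?_
  rw [ν.map_neg, ν.map_mul, ← h0, ν.map_mul]
  rw [ν.map_mul] at h0
  have hc' : ν c ≠ ⊤ := by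
    intro h; simp [h] at h0
  exact WithTop.add_lt_add_right hc' hfg

theorem InitUnit.neg {f : K[X]} (h : InitUnit ν f) : InitUnit ν (-f) := by
  obtain ⟨c, hc⟩ := h
  exact ⟨-c, by rwa [neg_mul_neg]⟩

theorem InitUnit.left_of_mul {f g : K[X]} (h : InitUnit ν (f * g)) : InitUnit ν f := by
  obtain ⟨c, hc⟩ := h
  exact ⟨g * c, by rwa [← mul_assoc]⟩

theorem InitUnit.mul {f g : K[X]} (hf : InitUnit ν f) (hg : InitUnit ν g) :
    InitUnit ν (f * g) := by
  obtain ⟨c, hc⟩ := hf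
  obtain ⟨d, hd⟩ := hg
  refine ⟨c * d, ?_⟩
  have e : 1 - f * g * (c * d) = (1 - f * c) + (f * c) * (1 - g * d) := by ring
  rw [e]
  refine ν.map_lt_add hc ?_
  rwa [ν.map_mul, val_eq_zero_of_pos hc, zero_add]

theorem initUnit_C {a : K} (ha : a ≠ 0) : InitUnit ν (C a) :=
  ⟨C a⁻¹, by rw [← C_mul, mul_inv_cancel₀ ha]; simp⟩

theorem initUnit_one : InitUnit ν 1 := ⟨1, by simp⟩

/-- The initial form of -φg equals that of f, and a factor of a unit is a unit. This is how
cancellation against a multiple of φ is excluded when φ is not a unit. -/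
theorem InitUnit.of_ideal_add {f g : K[X]} (h : InitUnit ν f) (hlt : ν f < ν (f + φ * g)) :
    InitUnit ν φ := by
  have : InitUnit ν (-(φ * g)) := by
    refine h.of_lt ?_
    have e : -(φ * g) - f = -(f + φ * g) := by ring
    rwa [e, ν.map_neg]
  have h2 := this.neg
  rw [neg_neg] at h2
  exact h2.left_of_mul

/-- `φ` is a monic polynomial of least degree whose initial form is not a unit. -/
structure IsMinNonunit (ν : AddValuation K[X] (WithTop Λ)) (φ : K[X]) : Prop where
  monic : φ.Monic
  not_unit : ¬ InitUnit ν φ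
  unit_of_lt : ∀ a : K[X], a ≠ 0 → a.degree < φ.degree → InitUnit ν a

/-- The value of a polynomial is at most the value of its remainder modulo `Q`. -/
def HasRem (ρ : AddValuation K[X] (WithTop Λ)) (Q : K[X]) : Prop :=
  ∀ a q : K[X], a.degree < Q.degree → ρ (a + Q * q) ≤ ρ a

theorem IsMinNonunit.degree_pos (h : IsMinNonunit ν φ) : 0 < φ.degree := by
  by_contra h0
  have h1 := h.monic.eq_one_of_isUnit (isUnit_iff_degree_eq_zero.2
    (le_antisymm (not_lt.1 h0) (zero_le_degree_iff.2 h.monic.ne_zero)))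
  exact h.not_unit (h1 ▸ initUnit_one)

theorem exists_isMinNonunit {f : K[X]} (hf : f ≠ 0) (h : ¬ InitUnit ν f) :
    ∃ φ, IsMinNonunit ν φ := by
  classical
  have hex : ∃ n, ∃ g : K[X], g.natDegree = n ∧ g ≠ 0 ∧ ¬ InitUnit ν g := ⟨_, f, rfl, hf, h⟩
  obtain ⟨g, hg, hg0, hgu⟩ := Nat.find_spec hex
  have hl : g.leadingCoeff⁻¹ ≠ 0 := inv_ne_zero (leadingCoeff_ne_zero.2 hg0)
  refine ⟨g * C g.leadingCoeff⁻¹, monic_mul_leadingCoeff_inv hg0,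
    fun hu => hgu hu.left_of_mul, fun a ha hlt => ?_⟩
  by_contra hau
  rw [degree_mul_C hl] at hlt
  have := natDegree_lt_natDegree ha hlt
  rw [hg] at this
  exact Nat.find_min hex this ⟨a, rfl, ha, hau⟩

theorem IsMinNonunit.hasRem (h : IsMinNonunit ν φ) : HasRem ν φ := by
  intro a q ha
  by_contra hlt
  rw [not_le] at hlt
  have ha0 : a ≠ 0 := by rintro rfl; simp at hlt
  exact h.not_unit ((h.unit_of_lt a ha0 ha).of_ideal_add hlt)

theorem HasRem.val_le_mul (h : HasRem ρ Q) {a q : K[X]} (ha : a.degree < Q.degree) :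
    ρ (a + Q * q) ≤ ρ (Q * q) := by
  have h1 := ρ.map_le_sub le_rfl (h a q ha)
  rwa [add_sub_cancel_left] at h1

/-- Nonzero a and b are units, hence so is their product; a jump in value of the remainder would
make φ a unit. This makes `residueVal` multiplicative. -/
theorem IsMinNonunit.val_remainder (h : IsMinNonunit ν φ) {a b r q : K[X]}
    (ha : a.degree < φ.degree) (hb : b.degree < φ.degree) (hr : r.degree < φ.degree)
    (e : a * b = r + φ * q) : ν r = ν a + ν b := by
  rw [← ν.map_mul]
  refine le_antisymm ?_ (e ▸ h.hasRem r q hr)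
  by_contra hlt
  rw [not_le] at hlt
  have ha0 : a ≠ 0 := by rintro rfl; simp at hlt
  have hb0 : b ≠ 0 := by rintro rfl; simp at hlt
  have hu := (h.unit_of_lt a ha0 ha).mul (h.unit_of_lt b hb0 hb)
  refine h.not_unit (InitUnit.of_ideal_add (f := a * b) (g := -q) hu ?_)
  have e2 : a * b + φ * -q = r := by rw [e]; ring
  rwa [e2]

theorem one_mod {φ : K[X]} (hm : φ.Monic) (hd : 0 < φ.degree) : (1 : K[X]) %ₘ φ = 1 :=
  (modByMonic_eq_self_iff hm).2 (by rwa [degree_one])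

/-- The valuation with support `φ` induced by `ν`. -/
def residueVal (ν : AddValuation K[X] (WithTop Λ)) (φ : K[X]) (h : IsMinNonunit ν φ) :
    AddValuation K[X] (WithTop Λ) :=
  AddValuation.of (fun f => ν (f %ₘ φ)) (by simp)
    (by simp [one_mod h.monic h.degree_pos])
    (fun f g => by rw [add_modByMonic]; exact ν.map_add _ _)
    (fun f g => by
      rw [mul_modByMonic]
      exact h.val_remainder (degree_modByMonic_lt f h.monic) (degree_modByMonic_lt g h.monic)
        (degree_modByMonic_lt _ h.monic) (modByMonic_add_div _ _).symm)

theorem residueVal_apply (h : IsMinNonunit ν φ) (f : K[X]) :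
    residueVal ν φ h f = ν (f %ₘ φ) := rfl

theorem le_residueVal (h : IsMinNonunit ν φ) (f : K[X]) : ν f ≤ residueVal ν φ h f := by
  rw [residueVal_apply]
  conv_lhs => rw [← modByMonic_add_div f φ]
  exact h.hasRem _ _ (degree_modByMonic_lt f h.monic)

theorem residueVal_eq_top_iff (h : IsMinNonunit ν φ) (f : K[X]) :
    residueVal ν φ h f = ⊤ ↔ φ ∣ f := by
  rw [residueVal_apply, ← modByMonic_eq_zero_iff_dvd h.monic]
  refine ⟨fun ht => ?_, fun h0 => by simp [h0]⟩
  by_contra h0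
  exact (h.unit_of_lt _ h0 (degree_modByMonic_lt f h.monic)).ne_top ht

theorem IsMinNonunit.irreducible (h : IsMinNonunit ν φ) : Irreducible φ := by
  rw [h.monic.irreducible_iff_natDegree']
  refine ⟨fun h1 => h.not_unit (h1 ▸ initUnit_one), fun f g hf hg e hlt => ?_⟩
  have hpos : 0 < φ.natDegree := natDegree_pos_iff_degree_pos.2 h.degree_pos
  rw [Finset.mem_Ioc] at hlt
  have hdeg : f.natDegree + g.natDegree = φ.natDegree := by
    rw [← e, hf.natDegree_mul hg]
  refine h.not_unit (e ▸ (h.unit_of_lt f hf.ne_zero ?_).mul (h.unit_of_lt g hg.ne_zero ?_))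
  · exact degree_lt_degree (by omega)
  · exact degree_lt_degree (by omega)

theorem degree_zero_lt (hQ : Q.Monic) : (0 : K[X]).degree < Q.degree := by
  rw [degree_zero, bot_lt_iff_ne_bot, Ne, degree_eq_bot]
  exact hQ.ne_zero

theorem degree_divByMonic_pow_lt (hQ : Q.Monic) {s : ℕ} {g : K[X]}
    (hg : g.degree < (Q ^ (s + 1)).degree) : (g /ₘ Q).degree < (Q ^ s).degree := by
  by_cases h0 : g /ₘ Q = 0
  · rw [h0]
    exact degree_zero_lt (hQ.pow s)
  · have hle : Q.degree ≤ g.degree := by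
      by_contra hlt
      exact h0 ((divByMonic_eq_zero_iff hQ).2 (not_le.1 hlt))
    rw [← degree_add_divByMonic hQ hle, pow_succ, degree_mul, add_comm] at hg
    exact lt_of_add_lt_add_right hg

/-- Induction on s: discarding the remainder of g modulo Q cannot lower the value, and then one
factor Q is removed. -/
theorem HasRem.val_add_le (h : HasRem ρ Q) (hQ : Q.Monic) (s : ℕ)
    {c g : K[X]} (hg : g.degree < (Q ^ s).degree) :
    ρ (c * Q ^ s + g) ≤ ρ (c * Q ^ s) := by
  induction s generalizing g with
  | zero =>
    have : g = 0 := by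
      rw [pow_zero, degree_one] at hg
      by_contra h0
      exact absurd hg (not_lt.2 (zero_le_degree_iff.2 h0))
    simp [this]
  | succ s ih =>
    have hr := degree_modByMonic_lt g hQ
    have e : c * Q ^ (s + 1) + g = g %ₘ Q + Q * (c * Q ^ s + g /ₘ Q) := by
      conv_lhs => rw [← modByMonic_add_div g Q]
      ring
    have hdeg := degree_divByMonic_pow_lt hQ hg
    calc ρ (c * Q ^ (s + 1) + g) ≤ ρ (Q * (c * Q ^ s + g /ₘ Q)) := by
          rw [e]; exact h.val_le_mul hr
      _ = ρ Q + ρ (c * Q ^ s + g /ₘ Q) := ρ.map_mul _ _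
      _ ≤ ρ Q + ρ (c * Q ^ s) := add_le_add_right (ih hdeg) _
      _ = ρ (c * Q ^ (s + 1)) := by
          rw [← ρ.map_mul]; congr 1; ring

/-- The powers f ^ deg Q and Q ^ deg f are monic of the same degree, so the first is the second plus
terms of lower degree, and `HasRem.val_add_le` applies with c = 1. -/
theorem HasRem.nsmul_val_le (h : HasRem ρ Q) (hQ : Q.Monic) {f : K[X]}
    (hf : f.Monic) : Q.natDegree • ρ f ≤ f.natDegree • ρ Q := by
  rw [← ρ.map_pow, ← ρ.map_pow]
  have hdeg : (f ^ Q.natDegree).degree = (Q ^ f.natDegree).degree := by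
    rw [degree_eq_natDegree (hf.pow _).ne_zero, degree_eq_natDegree (hQ.pow _).ne_zero,
      hf.natDegree_pow, hQ.natDegree_pow, mul_comm]
  have h1 := h.val_add_le hQ f.natDegree (c := 1) (g := f ^ Q.natDegree - Q ^ f.natDegree)
    (by
      rw [← hdeg]
      exact degree_sub_lt_left hdeg (hf.pow _).ne_zero (by rw [(hf.pow _), (hQ.pow _)]))
  simpa using h1

end Arithmetic

/-! ### The tangent direction as the polynomials that first separate two valuations. -/

section Tangent

variable {K Λ : Type*} [Field K] [AddCommGroup Λ] [LinearOrder Λ] [IsOrderedAddMonoid Λ]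
variable {μ ν ρ : AddValuation K[X] (WithTop Λ)} {Q φ : K[X]}

/-- `Q` separates `μ` from `ρ` and no polynomial of smaller degree does. -/
structure Separates (μ ρ : AddValuation K[X] (WithTop Λ)) (Q : K[X]) : Prop where
  monic : Q.Monic
  lt : μ Q < ρ Q
  eq_of_lt : ∀ a : K[X], a.degree < Q.degree → μ a = ρ a

theorem Separates.degree_pos (h : Separates μ ρ Q) : 0 < Q.degree := by
  by_contra h0
  have h1 := h.monic.eq_one_of_isUnit (isUnit_iff_degree_eq_zero.2
    (le_antisymm (not_lt.1 h0) (zero_le_degree_iff.2 h.monic.ne_zero)))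
  have := h.lt
  simp [h1] at this

theorem Separates.natDegree_pos (h : Separates μ ρ Q) : 0 < Q.natDegree :=
  natDegree_pos_iff_degree_pos.2 h.degree_pos

/-- Divide Q by the monic multiple b of a. The remainder r is a unit by induction on the degree, and
since ρ(r) < ρ(Q), the product bq has the initial form of -r. So b is a unit. -/
theorem Separates.initUnit (h : Separates μ ρ Q) (a : K[X]) (ha0 : a ≠ 0)
    (ha : a.degree < Q.degree) : InitUnit ρ a := by
  induction hn : a.natDegree using Nat.strong_induction_on generalizing a with
  | _ n ih =>
    by_cases hn0 : a.natDegree = 0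
    · rw [eq_C_of_natDegree_eq_zero hn0] at ha0 ⊢
      exact initUnit_C (by simpa using ha0)
    set b := a * C a.leadingCoeff⁻¹ with hb
    have hl : a.leadingCoeff⁻¹ ≠ 0 := inv_ne_zero (leadingCoeff_ne_zero.2 ha0)
    have hbm : b.Monic := monic_mul_leadingCoeff_inv ha0
    have hbd : b.degree = a.degree := degree_mul_C hl
    suffices hbu : InitUnit ρ b from hbu.left_of_mul
    have hb1 : 0 < b.degree := by
      rw [hbd]; exact natDegree_pos_iff_degree_pos.1 (Nat.pos_of_ne_zero hn0)
    have hrd := degree_modByMonic_lt Q hbm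
    have hqd : (Q /ₘ b).degree < Q.degree :=
      degree_divByMonic_lt Q b h.monic.ne_zero hb1
    have hQe := modByMonic_add_div Q b
    set r := Q %ₘ b
    set q := Q /ₘ b
    have e1 : μ (b * q) = ρ (b * q) := by
      rw [μ.map_mul, ρ.map_mul, h.eq_of_lt _ (hbd ▸ ha), h.eq_of_lt _ hqd]
    have e2 : μ r = ρ r := h.eq_of_lt _ (hrd.trans (hbd ▸ ha))
    -- Otherwise μ(bq) = μ(Q) < ρ(Q) ≤ ρ(bq), although μ and ρ agree on both factors, whose degrees
    -- are less than deg Q.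
    have hlt : ρ r < ρ Q := by
      by_contra hge
      rw [not_lt] at hge
      have h1 : μ Q < μ r := by rw [e2]; exact h.lt.trans_le hge
      have h2 : b * q = Q - r := by rw [← hQe]; ring
      have h3 : μ (b * q) = μ Q := by rw [h2]; exact μ.map_sub_eq_of_lt_left h1
      have h4 : ρ Q ≤ ρ (b * q) := by rw [h2]; exact ρ.map_le_sub le_rfl hge
      rw [← e1, h3] at h4
      exact absurd h.lt (not_lt.2 h4)
    have hr0 : r ≠ 0 := by
      intro h0; rw [h0] at hlt; simp at hlt
    have hru : InitUnit ρ r := by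
      refine ih r.natDegree ?_ r hr0 (hrd.trans (hbd ▸ ha)) rfl
      have := natDegree_lt_natDegree hr0 hrd
      rw [natDegree_eq_of_degree_eq hbd] at this
      omega
    exact hru.of_ideal_add (g := q) (by rwa [hQe])

theorem Separates.lt_val_mul (h : Separates μ ν Q) (hle : ∀ f, μ f ≤ ν f) {x : WithTop Λ} {c : K[X]}
    (hx : x ≤ μ (Q * c)) (hx' : x ≠ ⊤) : x < ν (Q * c) := by
  rw [μ.map_mul] at hx
  rw [ν.map_mul]
  by_cases hc : μ c = ⊤
  · have : ν c = ⊤ := top_le_iff.1 (hc ▸ hle c)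
    simpa [this] using lt_top_iff_ne_top.2 hx'
  · exact hx.trans_lt (WithTop.add_lt_add_of_lt_of_le hc h.lt (hle c))

/-- If a cancelled against Qq under μ, then ν would raise Qq strictly above ν(a) = μ(a), and the sum
would have smaller value under ν than under μ. -/
theorem Separates.hasRem (h : Separates μ ν Q) (hle : ∀ f, μ f ≤ ν f) : HasRem μ Q := by
  intro a q ha
  by_contra hlt
  rw [not_le] at hlt
  have h1 : μ (Q * q) = μ a := by
    have e : Q * q = (a + Q * q) - a := by ring
    rw [e]; exact μ.map_sub_eq_of_lt_right hlt
  have h2 : μ a < ν (Q * q) := h.lt_val_mul hle h1.ge hlt.ne_top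
  rw [h.eq_of_lt a ha] at h2 hlt
  have h3 := ν.map_add_eq_of_lt_left h2
  exact absurd (hle (a + Q * q)) (not_le.2 (h3 ▸ hlt))

/-- If μ(r) exceeded μ(ab), then both r and Qc would have ν-value above μ(ab) = ν(ab). This is the
compatibility that `augment` requires. -/
theorem Separates.val_remainder (h : Separates μ ν Q) (hle : ∀ f, μ f ≤ ν f) {a b r c : K[X]}
    (ha : a.degree < Q.degree) (hb : b.degree < Q.degree) (hr : r.degree < Q.degree)
    (e : a * b = r + Q * c) : μ r = μ a + μ b := by
  rw [← μ.map_mul]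
  have hrem := h.hasRem hle
  refine le_antisymm ?_ (e ▸ hrem r c hr)
  by_contra hlt
  rw [not_le] at hlt
  have h1 : μ (a * b) ≤ μ (Q * c) := by rw [e]; exact hrem.val_le_mul hr
  have h2 := h.lt_val_mul hle h1 hlt.ne_top
  have h3 : μ (a * b) = ν (a * b) := by
    rw [μ.map_mul, ν.map_mul, h.eq_of_lt a ha, h.eq_of_lt b hb]
  rw [h.eq_of_lt r hr] at hlt
  have h4 := ν.map_lt_add hlt h2
  rw [← e, h3] at h4
  exact lt_irrefl _ h4

/-- Apply the inequality to a and to its inverse, whose values add up to 0. -/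
theorem val_C_eq (hle : ∀ f, μ f ≤ ν f) (a : K) : μ (C a) = ν (C a) := by
  by_cases ha : a = 0
  · simp [ha]
  have h1 : μ (C a) + μ (C a⁻¹) = 0 := by
    rw [← μ.map_mul, ← C_mul, mul_inv_cancel₀ ha]; simp
  have h2 : ν (C a) + ν (C a⁻¹) = 0 := by
    rw [← ν.map_mul, ← C_mul, mul_inv_cancel₀ ha]; simp
  refine le_antisymm (hle _) ?_
  by_contra hlt
  rw [not_le] at hlt
  have hne : μ (C a⁻¹) ≠ ⊤ := by intro h; simp [h] at h1
  have := WithTop.add_lt_add_of_lt_of_le hne hlt (hle (C a⁻¹))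
  rw [h1, h2] at this
  exact lt_irrefl _ this

theorem val_mul_C_lt_iff (hle : ∀ f, μ f ≤ ν f) {a : K} (ha : a ≠ 0) (f : K[X]) :
    μ (f * C a) < ν (f * C a) ↔ μ f < ν f := by
  rw [μ.map_mul, ν.map_mul, val_C_eq hle]
  exact WithTop.add_lt_add_iff_right (initUnit_C ha).ne_top

theorem mem_tangent_iff (hle : ∀ f, μ f ≤ ν f) : Q ∈ tangent μ ν ↔ Separates μ ν Q := by
  constructor
  · rintro ⟨hm, hlt, hmin⟩
    refine ⟨hm, hlt, fun a ha => ?_⟩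
    by_contra hne
    have hlt' := lt_of_le_of_ne (hle a) hne
    have ha0 : a ≠ 0 := by rintro rfl; simp at hne
    have hl : a.leadingCoeff⁻¹ ≠ 0 := inv_ne_zero (leadingCoeff_ne_zero.2 ha0)
    have := hmin _ (monic_mul_leadingCoeff_inv ha0) ((val_mul_C_lt_iff hle hl a).2 hlt')
    rw [natDegree_mul_C hl] at this
    exact absurd (natDegree_lt_natDegree ha0 ha) (not_lt.2 this)
  · rintro ⟨hm, hlt, hmin⟩
    refine ⟨hm, hlt, fun ψ hψ hψlt => ?_⟩
    by_contra hd
    exact hψlt.ne (hmin ψ (degree_lt_degree (not_le.1 hd)))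

theorem tangent_nonempty (hle : ∀ f, μ f ≤ ν f) (hne : μ ≠ ν) : ∃ Q, Q ∈ tangent μ ν := by
  classical
  have hex : ∃ n, ∃ g : K[X], g.natDegree = n ∧ g.Monic ∧ μ g < ν g := by
    obtain ⟨f, hf⟩ : ∃ f, μ f ≠ ν f := by
      by_contra! h
      exact hne (AddValuation.ext h)
    have hf0 : f ≠ 0 := by rintro rfl; simp at hf
    have hl : f.leadingCoeff⁻¹ ≠ 0 := inv_ne_zero (leadingCoeff_ne_zero.2 hf0)
    exact ⟨_, _, rfl, monic_mul_leadingCoeff_inv hf0,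
      (val_mul_C_lt_iff hle hl f).2 (lt_of_le_of_ne (hle f) hf)⟩
  obtain ⟨g, hg, hgm, hglt⟩ := Nat.find_spec hex
  exact ⟨g, hgm, hglt, fun ψ hψ hlt => hg ▸ Nat.find_min' hex ⟨ψ, rfl, hψ, hlt⟩⟩

theorem tangentDegree_eq (hQ : Q ∈ tangent μ ν) : tangentDegree μ ν = Q.natDegree := by
  refine le_antisymm (Nat.sInf_le ⟨Q, hQ, rfl⟩) ?_
  refine le_csInf ⟨_, Q, hQ, rfl⟩ ?_
  rintro _ ⟨P, hP, rfl⟩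
  exact hQ.2.2 P hP.1 hP.2.1

/-- The degree of the tangent direction of `μ` towards `ν` is at most the degree of `ν`. -/
theorem Separates.natDegree_le (h : Separates μ ν Q) (hφ : IsMinNonunit ν φ) :
    Q.natDegree ≤ φ.natDegree := by
  by_contra hlt
  rw [not_le] at hlt
  have hdeg : φ.degree < Q.degree := degree_lt_degree hlt
  -- If deg φ < deg Q, then μ and ν agree on φ and on all remainders modulo φ; induction along the
  -- φ-expansion gives ν ≤ μ, which fails at Q.
  have key : ∀ f, ν f ≤ μ f := by
    refine induction_divByMonic hφ.monic hφ.degree_pos (by simp) fun a q ha ih => ?_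
    refine μ.map_le_add ?_ ?_
    · rw [h.eq_of_lt a (ha.trans hdeg)]
      exact hφ.hasRem a q ha
    · refine (hφ.hasRem.val_le_mul ha).trans ?_
      rw [ν.map_mul, μ.map_mul, h.eq_of_lt φ hdeg]
      exact add_le_add_right ih _
  exact absurd h.lt (not_lt.2 (key Q))

end Tangent

/-! ### Construction of the augmented valuation and its action on expansions. -/

section Augmentation

variable {K Λ : Type*} [Field K] [AddCommGroup Λ] [LinearOrder Λ] [IsOrderedAddMonoid Λ]
variable {μ ν ρ : AddValuation K[X] (WithTop Λ)} {Q φ : K[X]}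

open Classical in
/-- The truncation `∑ aᵢ Q ^ i ↦ min (μ aᵢ + i γ)`. -/
def truncation (μ : AddValuation K[X] (WithTop Λ)) (Q : K[X]) (hd : 0 < Q.degree) (γ : WithTop Λ)
    (f : K[X]) : WithTop Λ :=
  if _h : f = 0 then ⊤
  else min (μ (f %ₘ Q)) (γ + truncation μ Q hd γ (f /ₘ Q))
termination_by f.degree
decreasing_by exact degree_divByMonic_lt f Q _h hd

variable {γ : WithTop Λ}

theorem truncation_zero (hd : 0 < Q.degree) : truncation μ Q hd γ 0 = ⊤ := by
  rw [truncation]; simp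

theorem truncation_add (hQ : Q.Monic) (hd : 0 < Q.degree) {a : K[X]} (ha : a.degree < Q.degree)
    (q : K[X]) :
    truncation μ Q hd γ (a + Q * q) = min (μ a) (γ + truncation μ Q hd γ q) := by
  obtain ⟨h1, h2⟩ := div_modByMonic_unique q a hQ ⟨rfl, ha⟩
  rw [truncation, h1, h2]
  split_ifs with h
  · rw [h] at h1 h2
    simp only [zero_divByMonic, zero_modByMonic] at h1 h2
    rw [← h1, ← h2]
    simp [truncation_zero hd]
  · rfl

theorem truncation_of_lt (hQ : Q.Monic) (hd : 0 < Q.degree) {a : K[X]} (ha : a.degree < Q.degree) :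
    truncation μ Q hd γ a = μ a := by
  have := truncation_add (μ := μ) (γ := γ) hQ hd ha 0
  simpa [truncation_zero hd] using this

theorem truncation_mul_left (hQ : Q.Monic) (hd : 0 < Q.degree) (q : K[X]) :
    truncation μ Q hd γ (Q * q) = γ + truncation μ Q hd γ q := by
  have := truncation_add (μ := μ) (γ := γ) hQ hd (a := 0) (degree_zero_lt hQ) q
  simpa using this

theorem min_truncation_le_add (hQ : Q.Monic) (hd : 0 < Q.degree) (f g : K[X]) :
    min (truncation μ Q hd γ f) (truncation μ Q hd γ g) ≤ truncation μ Q hd γ (f + g) := by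
  revert g
  refine induction_divByMonic hQ hd (P := fun f => ∀ g, min (truncation μ Q hd γ f)
    (truncation μ Q hd γ g) ≤ truncation μ Q hd γ (f + g)) (by simp) (fun a q ha ih g => ?_) f
  have hb := degree_modByMonic_lt g hQ
  have hg := modByMonic_add_div g Q
  have e : a + Q * q + g = (a + g %ₘ Q) + Q * (q + g /ₘ Q) := by
    conv_lhs => rw [← hg]
    ring
  rw [e, truncation_add hQ hd ((degree_add_le _ _).trans_lt (max_lt ha hb)),
    truncation_add hQ hd ha]
  conv_lhs => rw [← hg, truncation_add hQ hd hb]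
  have h1 := ih (g /ₘ Q)
  refine le_min ?_ ?_
  · refine μ.map_le_add ?_ ?_
    · exact (min_le_left _ _).trans (min_le_left _ _)
    · exact (min_le_right _ _).trans (min_le_left _ _)
  · refine le_trans ?_ (add_le_add_right h1 _)
    rw [← min_add_add_left]
    exact min_le_min (min_le_right _ _) (min_le_right _ _)

theorem val_add_truncation_le (hQ : Q.Monic) (hd : 0 < Q.degree)
    (hmul : ∀ a b r c : K[X], a.degree < Q.degree → b.degree < Q.degree → r.degree < Q.degree →
      a * b = r + Q * c → μ r = μ a + μ b)
    (hγ : μ Q ≤ γ) {a : K[X]} (ha : a.degree < Q.degree) (g : K[X]) :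
    μ a + truncation μ Q hd γ g ≤ truncation μ Q hd γ (a * g) := by
  refine induction_divByMonic hQ hd (P := fun g => μ a + truncation μ Q hd γ g ≤
    truncation μ Q hd γ (a * g)) (by simp [truncation_zero hd]) (fun b q hb ih => ?_) g
  have hr := degree_modByMonic_lt (a * b) hQ
  have hab := modByMonic_add_div (a * b) Q
  -- Since deg(ab) < 2 deg Q, the product ab has only two terms in its Q-expansion.
  have hcd : (a * b /ₘ Q).degree < Q.degree := by
    by_cases hab0 : a * b = 0
    · rw [hab0, zero_divByMonic]
      exact degree_zero_lt hQ
    by_cases h0 : a * b /ₘ Q = 0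
    · rw [h0]
      exact degree_zero_lt hQ
    refine degree_lt_degree ?_
    have h1 := natDegree_divByMonic (a * b) hQ
    have h2 := natDegree_lt_natDegree (left_ne_zero_of_mul hab0) ha
    have h3 := natDegree_lt_natDegree (right_ne_zero_of_mul hab0) hb
    rw [natDegree_mul (left_ne_zero_of_mul hab0) (right_ne_zero_of_mul hab0)] at h1
    omega
  have hrv := hmul a b _ _ ha hb hr hab.symm
  have hcv : μ a + μ b ≤ μ (Q * (a * b /ₘ Q)) := by
    have e : Q * (a * b /ₘ Q) = a * b - a * b %ₘ Q := by
      rw [eq_sub_iff_add_eq, add_comm]; exact hab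
    rw [e]
    exact μ.map_le_sub (μ.map_mul _ _).ge hrv.ge
  have e : a * (b + Q * q) = a * b %ₘ Q + Q * (a * b /ₘ Q + a * q) := by
    have : a * b %ₘ Q = a * b - Q * (a * b /ₘ Q) := by
      rw [eq_sub_iff_add_eq]; exact hab
    rw [this]; ring
  rw [e, truncation_add hQ hd hr, truncation_add hQ hd hb, hrv]
  refine le_min (add_le_add_right (min_le_left _ _) _) ?_
  have h1 := min_truncation_le_add (μ := μ) (γ := γ) hQ hd (a * b /ₘ Q) (a * q)
  refine le_trans ?_ (add_le_add_right h1 _)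
  rw [← min_add_add_left, ← min_add_add_left]
  refine min_le_min ?_ ?_
  · rw [truncation_of_lt hQ hd hcd]
    rw [μ.map_mul] at hcv
    exact hcv.trans (add_le_add_left hγ _)
  · calc μ a + (γ + truncation μ Q hd γ q) = γ + (μ a + truncation μ Q hd γ q) := by
          rw [add_left_comm]
      _ ≤ _ := add_le_add_right ih _

theorem truncation_add_le_mul (hQ : Q.Monic) (hd : 0 < Q.degree)
    (hmul : ∀ a b r c : K[X], a.degree < Q.degree → b.degree < Q.degree → r.degree < Q.degree →
      a * b = r + Q * c → μ r = μ a + μ b)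
    (hγ : μ Q ≤ γ) (f g : K[X]) :
    truncation μ Q hd γ f + truncation μ Q hd γ g ≤ truncation μ Q hd γ (f * g) := by
  refine induction_divByMonic hQ hd (P := fun f => truncation μ Q hd γ f + truncation μ Q hd γ g ≤
    truncation μ Q hd γ (f * g)) (by simp [truncation_zero hd]) (fun a q ha ih => ?_) f
  have e : (a + Q * q) * g = a * g + Q * (q * g) := by ring
  rw [e, truncation_add hQ hd ha]
  refine le_trans ?_ (min_truncation_le_add hQ hd _ _)
  rw [← min_add_add_right]
  refine min_le_min (val_add_truncation_le hQ hd hmul hγ ha g) ?_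
  rw [truncation_mul_left hQ hd, add_assoc]
  exact add_le_add_right ih _

theorem truncation_add_of_lt (hQ : Q.Monic) (hd : 0 < Q.degree)
    (hmul : ∀ a b r c : K[X], a.degree < Q.degree → b.degree < Q.degree → r.degree < Q.degree →
      a * b = r + Q * c → μ r = μ a + μ b)
    (hγ : μ Q ≤ γ) {f g : K[X]} (h : truncation μ Q hd γ f < truncation μ Q hd γ g) :
    truncation μ Q hd γ (g + f) = truncation μ Q hd γ f := by
  refine le_antisymm ?_ (le_trans (le_min h.le le_rfl) (min_truncation_le_add hQ hd _ _))
  by_contra hlt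
  rw [not_le] at hlt
  have h1 : truncation μ Q hd γ g ≤ truncation μ Q hd γ (-g) := by
    have := val_add_truncation_le hQ hd hmul hγ (a := -1) (by rwa [degree_neg, degree_one]) g
    simpa using this
  have h2 := min_truncation_le_add (μ := μ) (γ := γ) hQ hd (g + f) (-g)
  rw [add_neg_cancel_comm] at h2
  exact absurd h2 (not_le.2 (lt_min hlt (h.trans_le h1)))

theorem truncation_mul (hQ : Q.Monic) (hd : 0 < Q.degree)
    (hmul : ∀ a b r c : K[X], a.degree < Q.degree → b.degree < Q.degree → r.degree < Q.degree →
      a * b = r + Q * c → μ r = μ a + μ b)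
    (hγ : μ Q ≤ γ) (f g : K[X]) :
    truncation μ Q hd γ (f * g) = truncation μ Q hd γ f + truncation μ Q hd γ g := by
  set T := truncation μ Q hd γ with hT
  have hsub := fun f g => truncation_add_le_mul (μ := μ) (γ := γ) hQ hd hmul hγ f g
  rw [← hT] at hsub
  -- cancelling the remainder of a factor that does not contribute
  have step : ∀ a q g : K[X], a.degree < Q.degree → T (q * g) = T q + T g →
      T (a + Q * q) < μ a → T ((a + Q * q) * g) = T (a + Q * q) + T g := by
    intro a q g ha ih hlt
    have h1 : T (a + Q * q) = γ + T q := by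
      have := truncation_add (μ := μ) (γ := γ) hQ hd ha q
      rw [← hT] at this
      rw [this] at hlt ⊢
      exact min_eq_right (le_of_not_ge fun hge => by rw [min_eq_left hge] at hlt; exact hlt.false)
    by_cases hg : T g = ⊤
    · exact le_antisymm (by simp [hg]) (hsub _ _)
    have h2 : T (Q * (q * g)) = T (a + Q * q) + T g := by
      rw [hT, truncation_mul_left hQ hd, ← hT, ih, h1, add_assoc]
    have h3 : T (Q * (q * g)) < T (a * g) := by
      rw [h2]
      exact (WithTop.add_lt_add_right hg hlt).trans_le
        (val_add_truncation_le hQ hd hmul hγ ha g)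
    have e : (a + Q * q) * g = a * g + Q * (q * g) := by ring
    rw [e, hT, truncation_add_of_lt hQ hd hmul hγ h3, ← hT, h2]
  revert g
  refine induction_divByMonic hQ hd (P := fun f => ∀ g, T (f * g) = T f + T g)
    (by simp [hT, truncation_zero hd]) (fun a q ha ih g => ?_) f
  by_cases h1 : T (a + Q * q) < μ a
  · exact step a q g ha (ih g) h1
  -- From here the remainder of the first factor attains its minimum. If that of the second factor
  -- does too, the remainder of the product has value μ(a) + μ(b), which bounds T of the product
  -- from above.
  have h1' : μ a ≤ T (a + Q * q) := not_lt.1 h1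
  refine induction_divByMonic hQ hd (P := fun g => T ((a + Q * q) * g) = T (a + Q * q) + T g)
    (by simp [hT, truncation_zero hd]) (fun b s hb ihs => ?_) g
  by_cases h2 : T (b + Q * s) < μ b
  · rw [mul_comm, add_comm (T _)]
    exact step b s _ hb (by rw [mul_comm, ihs, add_comm]) h2
  refine le_antisymm ?_ (hsub _ _)
  have hr := degree_modByMonic_lt (a * b) hQ
  have hab := modByMonic_add_div (a * b) Q
  have e : (a + Q * q) * (b + Q * s) =
      a * b %ₘ Q + Q * (a * b /ₘ Q + a * s + q * b + Q * (q * s)) := by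
    have : a * b %ₘ Q = a * b - Q * (a * b /ₘ Q) := by
      rw [eq_sub_iff_add_eq]; exact hab
    rw [this]; ring
  have h3 : T ((a + Q * q) * (b + Q * s)) ≤ μ (a * b %ₘ Q) := by
    rw [e, hT, truncation_add hQ hd hr]; exact min_le_left _ _
  rw [hmul a b _ _ ha hb hr hab.symm] at h3
  exact h3.trans (add_le_add h1' (not_lt.1 h2))

/-- The valuation `[μ; Q, γ]`. -/
def augment (μ : AddValuation K[X] (WithTop Λ)) (Q : K[X]) (γ : WithTop Λ)
    (hQ : Q.Monic) (hd : 0 < Q.degree)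
    (hmul : ∀ a b r c : K[X], a.degree < Q.degree → b.degree < Q.degree → r.degree < Q.degree →
      a * b = r + Q * c → μ r = μ a + μ b)
    (hγ : μ Q ≤ γ) : AddValuation K[X] (WithTop Λ) :=
  AddValuation.of (truncation μ Q hd γ) (truncation_zero hd)
    (by rw [truncation_of_lt hQ hd (by rwa [degree_one]), μ.map_one])
    (min_truncation_le_add hQ hd) (truncation_mul hQ hd hmul hγ)

theorem HasRem.val_add_eq (h : HasRem ρ Q) {a q : K[X]} (ha : a.degree < Q.degree) :
    ρ (a + Q * q) = min (ρ a) (ρ Q + ρ q) := by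
  rw [← ρ.map_mul]
  exact le_antisymm (le_min (h a q ha) (h.val_le_mul ha)) (ρ.map_add _ _)

theorem sum_range_succ_expansion (n : ℕ) (a : ℕ → K[X]) :
    ∑ i ∈ Finset.range (n + 1), a i * Q ^ i =
      a 0 + Q * ∑ i ∈ Finset.range n, a (i + 1) * Q ^ i := by
  rw [Finset.sum_range_succ', Finset.mul_sum, add_comm]
  congr 1
  · simp
  · exact Finset.sum_congr rfl fun i _ => by ring

theorem HasRem.val_sum (h : HasRem ρ Q) (n : ℕ) (a : ℕ → K[X])
    (ha : ∀ i, (a i).degree < Q.degree) :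
    ρ (∑ i ∈ Finset.range n, a i * Q ^ i) = (Finset.range n).inf fun i => ρ (a i) + i • ρ Q := by
  refine le_antisymm ?_ ?_
  · refine Finset.le_inf fun i hi => ?_
    induction n generalizing a i with
    | zero => simp at hi
    | succ n ih =>
      rw [sum_range_succ_expansion, h.val_add_eq (ha 0)]
      cases i with
      | zero => simp
      | succ i =>
        refine (min_le_right _ _).trans ?_
        rw [succ_nsmul', add_left_comm]
        refine add_le_add_right (ih (fun i => a (i + 1)) (fun i => ha _) i ?_) _
        simpa using hi
  · refine ρ.map_le_sum fun i hi => ?_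
    rw [ρ.map_mul, ρ.map_pow]
    exact Finset.inf_le hi

theorem HasRem.actsOnExpansions (h : HasRem ρ Q) (hμ : ∀ a : K[X], a.degree < Q.degree → μ a = ρ a) :
    ActsOnExpansions μ Q (ρ Q) ρ := by
  intro n a ha
  rw [h.val_sum n a ha]
  exact Finset.inf_congr rfl fun i _ => by rw [hμ _ (ha i)]

theorem ActsOnExpansions.eq_of_lt {β : K[X] → WithTop Λ} (h : ActsOnExpansions β Q γ ρ) {a : K[X]}
    (ha : a.degree < Q.degree) : ρ a = β a := by
  have := h 1 (fun _ => a) (fun _ => ha)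
  simpa using this

theorem ActsOnExpansions.val_eq {β : K[X] → WithTop Λ} (h : ActsOnExpansions β Q γ ρ)
    (hd : 0 < Q.degree) : ρ Q = γ := by
  have h1 : ∀ i, ((if i = 1 then 1 else 0 : K[X])).degree < Q.degree := by
    intro i
    split_ifs
    · rwa [degree_one]
    · rw [degree_zero]; exact (WithBot.bot_lt_coe 0).trans hd
  have h0 : β 0 = ⊤ := by rw [← h.eq_of_lt (a := 0) (by simpa using h1 0)]; simp
  have h1' : β 1 = 0 := by rw [← h.eq_of_lt (a := 1) (by simpa using h1 1)]; simp
  have := h 2 (fun i => if i = 1 then 1 else 0) h1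
  simpa [Finset.sum_range_succ, Finset.range_add_one, h0, h1'] using this

/-- The sequence `a, c 0, c 1, …`. -/
def consSeq (a : K[X]) (c : ℕ → K[X]) : ℕ → K[X]
  | 0 => a
  | i + 1 => c i

theorem degree_consSeq_lt {a : K[X]} {c : ℕ → K[X]} (ha : a.degree < Q.degree)
    (hc : ∀ i, (c i).degree < Q.degree) : ∀ i, (consSeq a c i).degree < Q.degree
  | 0 => ha
  | i + 1 => hc i

theorem sum_consSeq (n : ℕ) (a : K[X]) (c : ℕ → K[X]) :
    ∑ i ∈ Finset.range (n + 1), consSeq a c i * Q ^ i =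
      a + Q * ∑ i ∈ Finset.range n, c i * Q ^ i :=
  sum_range_succ_expansion n (consSeq a c)

theorem exists_expansion (hQ : Q.Monic) (hd : 0 < Q.degree) (f : K[X]) :
    ∃ (n : ℕ) (a : ℕ → K[X]), (∀ i, (a i).degree < Q.degree) ∧
      f = ∑ i ∈ Finset.range n, a i * Q ^ i := by
  refine induction_divByMonic hQ hd (P := fun f => ∃ (n : ℕ) (a : ℕ → K[X]),
    (∀ i, (a i).degree < Q.degree) ∧ f = ∑ i ∈ Finset.range n, a i * Q ^ i)
    ⟨0, 0, fun _ => degree_zero_lt hQ, by simp⟩ ?_ f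
  rintro a q ha ⟨n, c, hc, rfl⟩
  exact ⟨n + 1, consSeq a c, degree_consSeq_lt ha hc, (sum_consSeq n a c).symm⟩

theorem ActsOnExpansions.hasRem {β : K[X] → WithTop Λ} (h : ActsOnExpansions β Q γ ρ)
    (hQ : Q.Monic) (hd : 0 < Q.degree) : HasRem ρ Q := by
  intro a q ha
  obtain ⟨n, c, hc, rfl⟩ := exists_expansion hQ hd q
  have h1 := h (n + 1) (consSeq a c) (degree_consSeq_lt ha hc)
  rw [sum_consSeq] at h1
  rw [h1, h.eq_of_lt ha]
  refine (Finset.inf_le (Finset.mem_range.2 n.succ_pos)).trans ?_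
  simp [consSeq]

/-- The remainder of 1 - Qg modulo Q is 1, so its value is at most 0. -/
theorem HasRem.not_initUnit (h : HasRem ρ Q) (hd : 0 < Q.degree) : ¬ InitUnit ρ Q := by
  rintro ⟨g, hg⟩
  have := h 1 (-g) (by rwa [degree_one])
  rw [ρ.map_one] at this
  have e : 1 + Q * -g = 1 - Q * g := by ring
  rw [e] at this
  exact absurd hg (not_lt.2 this)

/-- The polynomials `Q` of the tangent direction define augmentations `[μ; Q, γ]`. -/
theorem Separates.exists_augmentation (h : Separates μ ν Q) (hle : ∀ f, μ f ≤ ν f) :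
    ∃ ρ : AddValuation K[X] (WithTop Λ), ActsOnExpansions μ Q (ν Q) ρ := by
  have hmul := fun a b r c ha hb hr e => h.val_remainder hle (a := a) (b := b) (r := r) (c := c)
    ha hb hr e
  have hd := h.degree_pos
  set ρ := augment μ Q (ν Q) h.monic hd hmul h.lt.le
  have hT : ∀ f, ρ f = truncation μ Q hd (ν Q) f := fun _ => rfl
  have hρQ : ρ Q = ν Q := by
    have := truncation_mul_left (μ := μ) (γ := ν Q) h.monic hd 1
    rw [mul_one] at this
    rw [hT, this, truncation_of_lt h.monic hd (by rwa [degree_one])]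
    simp
  refine ⟨ρ, hρQ ▸ HasRem.actsOnExpansions ?_ fun a ha => ?_⟩
  · intro a q ha
    rw [hT, hT, truncation_add h.monic hd ha, truncation_of_lt h.monic hd ha]
    exact min_le_left _ _
  · rw [hT, truncation_of_lt h.monic hd ha]

end Augmentation

/-! ### Uniqueness of the extension of v and the resulting lower bound for ρ(φ). -/

section Henselian

variable {K Λ : Type*} [Field K] [AddCommGroup Λ] [LinearOrder Λ] [IsOrderedAddMonoid Λ]
variable {v : AddValuation K (WithTop Λ)}

theorem exists_inverse_mod {φ f : K[X]} (hφ : Irreducible φ) (hf : ¬ φ ∣ f) :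
    ∃ g, φ ∣ f * g - 1 := by
  obtain ⟨a, b, hab⟩ := (hφ.coprime_iff_not_dvd).2 hf
  exact ⟨b, -a, by rw [← hab]; ring⟩

theorem val_eq_of_dvd_sub {w : AddValuation K[X] (WithTop Λ)} {φ f g : K[X]} (hφ : w φ = ⊤)
    (h : φ ∣ f - g) : w f = w g := by
  obtain ⟨c, hc⟩ := h
  have e : f = g + φ * c := by rw [← hc]; ring
  rw [e]
  exact w.map_add_supp g (by simp [hφ])

/-- Over a henselian field, the extension of `v` to `K[x] / φ` is the restriction of the extension
to the algebraic closure. -/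
theorem aeval_mem_iff {O : ValuationSubring (AlgebraicClosure K)}
    (hO : ∀ O' : ValuationSubring (AlgebraicClosure K),
      (∀ a : K, algebraMap K (AlgebraicClosure K) a ∈ O' ↔ 0 ≤ v a) → O' = O)
    {w : AddValuation K[X] (WithTop Λ)} (hw : Extends v w) {φ : K[X]} (hφ : Irreducible φ)
    (hsupp : ∀ f, w f = ⊤ ↔ φ ∣ f) {θ : AlgebraicClosure K} (hθ : aeval θ φ = 0) (f : K[X]) :
    aeval θ f ∈ O ↔ 0 ≤ w f := by
  have hφ' : w φ = ⊤ := (hsupp φ).2 dvd_rfl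
  have hdvd : ∀ g : K[X], aeval θ g = 0 ↔ φ ∣ g := by
    intro g
    refine ⟨fun hg => ?_, fun ⟨c, hc⟩ => by rw [hc, map_mul, hθ, zero_mul]⟩
    by_contra hnd
    obtain ⟨c, d, hcd⟩ := exists_inverse_mod hφ hnd
    have := congrArg (aeval θ) hcd
    simp [hg, hθ] at this
  have hwd : ∀ f g : K[X], aeval θ f = aeval θ g → w f = w g := by
    intro f g hfg
    exact val_eq_of_dvd_sub hφ' ((hdvd _).1 (by rw [map_sub, hfg, sub_self]))
  -- A is the valuation ring of w transported to K(θ), and I below is its maximal ideal.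
  let A : Subring (AlgebraicClosure K) :=
    { carrier := {y | ∃ g : K[X], aeval θ g = y ∧ 0 ≤ w g}
      mul_mem' := by
        rintro _ _ ⟨g, rfl, hg⟩ ⟨h, rfl, hh⟩
        exact ⟨g * h, map_mul _ _ _, by rw [w.map_mul]; exact add_nonneg hg hh⟩
      one_mem' := ⟨1, map_one _, by simp⟩
      add_mem' := by
        rintro _ _ ⟨g, rfl, hg⟩ ⟨h, rfl, hh⟩
        exact ⟨g + h, map_add _ _ _, w.map_le_add hg hh⟩
      zero_mem' := ⟨0, map_zero _, by simp⟩
      neg_mem' := by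
        rintro _ ⟨g, rfl, hg⟩
        exact ⟨-g, map_neg _ _, by rwa [w.map_neg]⟩ }
  let I : Ideal A :=
    { carrier := {y | ∃ g : K[X], aeval θ g = (y : AlgebraicClosure K) ∧ 0 < w g}
      add_mem' := by
        rintro ⟨_, _⟩ ⟨_, _⟩ ⟨g, rfl, hg⟩ ⟨h, rfl, hh⟩
        exact ⟨g + h, map_add _ _ _, w.map_lt_add hg hh⟩
      zero_mem' := ⟨0, map_zero _, by simp⟩
      smul_mem' := by
        rintro ⟨_, g, rfl, hg⟩ ⟨_, _⟩ ⟨h, rfl, hh⟩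
        exact ⟨g * h, map_mul _ _ _, by rw [w.map_mul]; exact hh.trans_le (le_add_of_nonneg_left hg)⟩ }
  have hI : I ≠ ⊤ := by
    rw [Ne, Ideal.eq_top_iff_one]
    rintro ⟨g, hg, hpos⟩
    have := hwd g 1 (by rw [hg]; simp)
    simp [this] at hpos
  -- Chevalley extension: a valuation ring B of the algebraic closure in which the elements of I are
  -- nonunits. It meets K(θ) exactly in A, hence extends v, and uniqueness forces B = O.
  obtain ⟨B, hAB, hIB⟩ := Ideal.image_subset_nonunits_valuationSubring I hI
  have hB : ∀ g : K[X], aeval θ g ∈ B ↔ 0 ≤ w g := by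
    intro g
    refine ⟨fun hg => ?_, fun hg => hAB ⟨g, rfl, hg⟩⟩
    by_contra hlt
    rw [not_le] at hlt
    have hnd : ¬ φ ∣ g := by
      intro h; rw [(hsupp g).2 h] at hlt; exact not_top_lt hlt
    obtain ⟨h, hh⟩ := exists_inverse_mod hφ hnd
    have h1 : aeval θ g * aeval θ h = 1 := by
      have := (hdvd _).2 hh
      rwa [map_sub, map_mul, map_one, sub_eq_zero] at this
    have h2 : w g + w h = 0 := by
      rw [← w.map_mul, val_eq_of_dvd_sub hφ' hh, w.map_one]
    have h3 : 0 < w h := by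
      by_contra hle
      rw [not_lt] at hle
      have := WithTop.add_lt_add_of_lt_of_le (ne_top_of_le_ne_top (by simp) hle) hlt hle
      rw [h2, zero_add] at this
      exact this.false
    have h4 : aeval θ h ∈ B.nonunits :=
      hIB ⟨⟨aeval θ h, h, rfl, h3.le⟩, ⟨h, rfl, h3⟩, rfl⟩
    rw [← inv_eq_of_mul_eq_one_right h1, B.inv_mem_nonunits_iff] at h4
    rcases h4 with h4 | h4
    · simp [h4] at h1
    · exact h4 hg
  have hBO : B = O := by
    refine hO B fun a => ?_
    rw [← hw a, ← hB (C a), aeval_C]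
  rw [← hBO, hB]

/-- The preimage of O under σ is again a valuation ring extending v, hence equals O. -/
theorem algEquiv_mem_iff {O : ValuationSubring (AlgebraicClosure K)}
    (hO' : ∀ a : K, algebraMap K (AlgebraicClosure K) a ∈ O ↔ 0 ≤ v a)
    (hO : ∀ O' : ValuationSubring (AlgebraicClosure K),
      (∀ a : K, algebraMap K (AlgebraicClosure K) a ∈ O' ↔ 0 ≤ v a) → O' = O)
    (σ : AlgebraicClosure K ≃ₐ[K] AlgebraicClosure K) (y : AlgebraicClosure K) :
    σ y ∈ O ↔ y ∈ O := by
  have h : O.comap (σ : AlgebraicClosure K →+* AlgebraicClosure K) = O := by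
    refine hO _ fun a => ?_
    rw [ValuationSubring.mem_comap, ← hO']
    simp
  conv_rhs => rw [← h]
  rw [ValuationSubring.mem_comap]
  rfl

theorem root_div_mem {O : ValuationSubring (AlgebraicClosure K)}
    (hO' : ∀ a : K, algebraMap K (AlgebraicClosure K) a ∈ O ↔ 0 ≤ v a)
    (hO : ∀ O' : ValuationSubring (AlgebraicClosure K),
      (∀ a : K, algebraMap K (AlgebraicClosure K) a ∈ O' ↔ 0 ≤ v a) → O' = O)
    {y z : AlgebraicClosure K} (hz : aeval z (minpoly K y) = 0) : z / y ∈ O := by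
  classical
  have halg : ∀ t : AlgebraicClosure K, IsAlgebraic K t := fun t => Algebra.IsAlgebraic.isAlgebraic t
  have hint : IsIntegral K y := (halg y).isIntegral
  have hroots : ∀ t, t ∈ ((minpoly K y).aroots (AlgebraicClosure K)).toFinset ↔
      aeval t (minpoly K y) = 0 := by
    intro t
    rw [Multiset.mem_toFinset, mem_aroots]
    exact and_iff_right (minpoly.ne_zero hint)
  -- Take t to be a conjugate of y at which `O.valuation` is largest and move y to t by an
  -- automorphism; z then goes to another conjugate, no larger than t, while membership in O is
  -- unchanged.
  obtain ⟨t, ht, hmax⟩ := Finset.exists_max_image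
    ((minpoly K y).aroots (AlgebraicClosure K)).toFinset O.valuation
    ⟨y, (hroots y).2 (minpoly.aeval K y)⟩
  obtain ⟨τ, rfl⟩ := minpoly.exists_algEquiv_of_root' (halg y) ((hroots t).1 ht)
  rw [← algEquiv_mem_iff hO' hO τ, map_div₀, ← O.valuation_le_one_iff, map_div₀]
  refine div_le_one_of_le₀ (hmax _ ((hroots _).2 ?_)) zero_le
  have := congrArg τ hz
  rwa [map_zero, ← AlgEquiv.coe_toAlgHom, ← aeval_algHom_apply] at this

theorem esymm_div_mem {L : Type*} [Field L] (O : ValuationSubring L) {y : L}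
    {s : Multiset L} (hs : ∀ z ∈ s, z / y ∈ O) (k : ℕ) : s.esymm k / y ^ k ∈ O := by
  refine Multiset.sum_induction (fun x => x / y ^ k ∈ O) _
    (fun a b ha hb => by rw [add_div]; exact O.add_mem _ _ ha hb) (by simp) ?_
  intro x hx
  obtain ⟨t, ht, rfl⟩ := Multiset.mem_map.1 hx
  obtain ⟨hts, rfl⟩ := Multiset.mem_powersetCard.1 ht
  have hts' : ∀ z ∈ t, z / y ∈ O := fun z hz => hs z (Multiset.mem_of_le hts hz)
  clear ht hts hx
  induction t using Multiset.induction with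
  | empty => simp
  | cons a t ih =>
    rw [Multiset.prod_cons, Multiset.card_cons, pow_succ', mul_div_mul_comm]
    exact O.mul_mem _ _ (hts' a (Multiset.mem_cons_self a t))
      (ih fun z hz => hts' z (Multiset.mem_cons_of_mem hz))

/-- Up to sign the coefficient is an elementary symmetric function of the conjugates of y,
homogeneous of degree equal to the codegree, and each conjugate divided by y lies in O. -/
theorem coeff_minpoly_div_mem {O : ValuationSubring (AlgebraicClosure K)}
    (hO' : ∀ a : K, algebraMap K (AlgebraicClosure K) a ∈ O ↔ 0 ≤ v a)
    (hO : ∀ O' : ValuationSubring (AlgebraicClosure K),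
      (∀ a : K, algebraMap K (AlgebraicClosure K) a ∈ O' ↔ 0 ≤ v a) → O' = O)
    {y : AlgebraicClosure K} {i : ℕ} (hi : i ≤ (minpoly K y).natDegree) :
    algebraMap K (AlgebraicClosure K) ((minpoly K y).coeff i) /
      y ^ ((minpoly K y).natDegree - i) ∈ O := by
  have hint : IsIntegral K y := (Algebra.IsAlgebraic.isAlgebraic y).isIntegral
  set p := (minpoly K y).map (algebraMap K (AlgebraicClosure K)) with hp
  have hdeg : p.natDegree = (minpoly K y).natDegree := natDegree_map _
  have hcard : p.roots.card = p.natDegree :=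
    (IsAlgClosed.splits p).natDegree_eq_card_roots.symm
  have hm : p.Monic := (minpoly.monic hint).map _
  rw [← coeff_map, ← hp, ← hdeg, coeff_eq_esymm_roots_of_card hcard (hdeg ▸ hi),
    hm.leadingCoeff, one_mul, mul_div_assoc]
  refine O.mul_mem _ _ (pow_mem (O.neg_mem _ O.one_mem) _) (esymm_div_mem O (fun z hz => ?_) _)
  refine root_div_mem hO' hO ?_
  rw [mem_roots hm.ne_zero, IsRoot.def, hp, eval_map_algebraMap] at hz
  exact hz

/-- An element of `K[x] / φ` of value at least `γ` satisfies a monic equation whose coefficient of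
codegree `k` has value at least `k γ`. -/
theorem exists_monic_dvd_comp (hv : IsHenselian v) {w : AddValuation K[X] (WithTop Λ)}
    (hw : Extends v w) {φ : K[X]} (hφ : Irreducible φ) (hsupp : ∀ f, w f = ⊤ ↔ φ ∣ f)
    {f : K[X]} {γ : WithTop Λ} (hγ : γ ≤ w f) :
    ∃ χ : K[X], χ.Monic ∧ φ ∣ χ.comp f ∧
      ∀ i ≤ χ.natDegree, (χ.natDegree - i) • γ ≤ v (χ.coeff i) := by
  by_cases hf : φ ∣ f
  -- Here f is zero in K[x]/φ, whose minimal polynomial is X.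
  · refine ⟨X, monic_X, by simpa using hf, fun i hi => ?_⟩
    rw [natDegree_X] at hi ⊢
    interval_cases i <;> simp
  obtain ⟨O, hO', hO⟩ := hv
  obtain ⟨θ, hθ⟩ := IsAlgClosed.exists_aeval_eq_zero (AlgebraicClosure K) φ
    (Irreducible.degree_pos hφ).ne'
  obtain ⟨g, hg⟩ := exists_inverse_mod hφ hf
  have hφ' : w φ = ⊤ := (hsupp φ).2 dvd_rfl
  have hmem := aeval_mem_iff hO hw hφ hsupp hθ
  have hfg : aeval θ f * aeval θ g = 1 := by
    obtain ⟨c, hc⟩ := hg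
    have := congrArg (aeval θ) hc
    rwa [map_mul, hθ, zero_mul, map_sub, map_mul, map_one, sub_eq_zero] at this
  have hwfg : w f + w g = 0 := by
    rw [← w.map_mul, val_eq_of_dvd_sub hφ' hg, w.map_one]
  have hint : IsIntegral K (aeval θ f) := (Algebra.IsAlgebraic.isAlgebraic _).isIntegral
  refine ⟨minpoly K (aeval θ f), minpoly.monic hint, ?_, fun i hi => ?_⟩
  · by_contra hnd
    obtain ⟨c, d, hcd⟩ := exists_inverse_mod hφ hnd
    have := congrArg (aeval θ) hcd
    simp [aeval_comp, hθ] at this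
  · have h1 := coeff_minpoly_div_mem hO' hO hi
    set k := (minpoly K (aeval θ f)).natDegree - i
    set c := (minpoly K (aeval θ f)).coeff i
    -- With g inverse to f modulo φ, the quotient c / f(θ)^k is the value at θ of a polynomial, so
    -- its membership in O becomes an inequality for w.
    have h2 : aeval θ (C c * g ^ k) =
        algebraMap K (AlgebraicClosure K) c / aeval θ f ^ k := by
      rw [map_mul, aeval_C, map_pow, ← inv_eq_of_mul_eq_one_right hfg, inv_pow, div_eq_mul_inv]
    rw [← h2, hmem, w.map_mul, hw c, w.map_pow] at h1
    have h3 := add_le_add_right h1 (k • w f)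
    rw [add_zero, add_left_comm, ← nsmul_add, hwfg, nsmul_zero, add_zero] at h3
    exact (nsmul_le_nsmul_right hγ k).trans h3

variable {μ ν ρ : AddValuation K[X] (WithTop Λ)} {Q φ : K[X]}

/-- Write χ(Q) = φg with χ from `exists_monic_dvd_comp`. Each term of χ(Q) has value at least deg χ
· ρ(Q), and g satisfies the upper bound `HasRem.nsmul_val_le`; subtracting the latter leaves the
lower bound for φ. -/
theorem nsmul_le_nsmul_val (hv : IsHenselian v) {w : AddValuation K[X] (WithTop Λ)}
    (hw : Extends v w) (hφ : Irreducible φ) (hφm : φ.Monic) (hsupp : ∀ f, w f = ⊤ ↔ φ ∣ f)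
    (hρ : Extends v ρ) (hrem : HasRem ρ Q) (hQ : Q.Monic) (hd : 0 < Q.natDegree)
    (hQt : ρ Q ≠ ⊤) (hQw : ρ Q ≤ w Q) :
    φ.natDegree • ρ Q ≤ Q.natDegree • ρ φ := by
  obtain ⟨χ, hχ, ⟨g, hg⟩, hcoeff⟩ := exists_monic_dvd_comp hv hw hφ hsupp hQw
  have hχQ : (χ.comp Q).Monic := hχ.comp hQ hd.ne'
  have hgm : g.Monic := hφm.of_mul_monic_left (hg ▸ hχQ)
  have hdeg : χ.natDegree * Q.natDegree = φ.natDegree + g.natDegree := by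
    rw [← natDegree_comp, hg, hφm.natDegree_mul hgm]
  have h1 : χ.natDegree • ρ Q ≤ ρ φ + ρ g := by
    rw [← ρ.map_mul, ← hg, comp_eq_sum_left, sum_over_range _ (by simp)]
    refine ρ.map_le_sum fun i hi => ?_
    have hi' : i ≤ χ.natDegree := by
      rw [Finset.mem_range] at hi; omega
    rw [ρ.map_mul, ρ.map_pow, hρ]
    calc χ.natDegree • ρ Q = (χ.natDegree - i) • ρ Q + i • ρ Q := by
          rw [← add_nsmul, Nat.sub_add_cancel hi']
      _ ≤ _ := add_le_add_left (hcoeff i hi') _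
  have h2 := hrem.nsmul_val_le hQ hgm
  have hfin : ∀ x : WithTop Λ, Q.natDegree • x ≠ ⊤ → x ≠ ⊤ := by
    rintro x hx rfl
    obtain ⟨n, hn⟩ := Nat.exists_eq_succ_of_ne_zero hd.ne'
    rw [hn, succ_nsmul] at hx
    simp at hx
  by_cases hφt : ρ φ = ⊤
  · rw [hφt]
    obtain ⟨n, hn⟩ := Nat.exists_eq_succ_of_ne_zero hd.ne'
    rw [hn, succ_nsmul]
    simp
  obtain ⟨c, hc⟩ := WithTop.ne_top_iff_exists.1 hQt
  obtain ⟨x, hx⟩ := WithTop.ne_top_iff_exists.1 hφt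
  have hgt : ρ g ≠ ⊤ := by
    refine hfin _ (ne_top_of_le_ne_top ?_ h2)
    rw [← hc, ← WithTop.coe_nsmul]
    exact WithTop.coe_ne_top
  obtain ⟨y, hy⟩ := WithTop.ne_top_iff_exists.1 hgt
  rw [← hc, ← hx, ← hy, ← WithTop.coe_nsmul, ← WithTop.coe_add, WithTop.coe_le_coe] at h1
  rw [← hc, ← hy, ← WithTop.coe_nsmul, ← WithTop.coe_nsmul, WithTop.coe_le_coe] at h2
  rw [← hc, ← hx, ← WithTop.coe_nsmul, ← WithTop.coe_nsmul, WithTop.coe_le_coe]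
  have h3 := nsmul_le_nsmul_right h1 Q.natDegree
  rw [← mul_nsmul, hdeg, add_nsmul, nsmul_add] at h3
  have h4 := h3.trans (add_le_add_right h2 _)
  exact le_of_add_le_add_right h4

/-- Over a henselian field, the `Q`-expansion of a minimal nonunit `φ` of `ν` has a leading term
`Q ^ s` which computes the value of `φ`. -/
theorem Separates.exists_natDegree_eq (hv : IsHenselian v) (hμ : Extends v μ)
    (hle : ∀ f, μ f ≤ ν f) (hQ : Separates μ ν Q) (hφ : IsMinNonunit ν φ)
    (hρ : ActsOnExpansions μ Q (ν Q) ρ) :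
    ∃ s, φ.natDegree = s * Q.natDegree ∧ (ρ φ = ⊤ → s = 1) ∧ ρ φ = s • ρ Q := by
  have hd := hQ.degree_pos
  have hd' := hQ.natDegree_pos
  have hρQ := hρ.val_eq hd
  have hrem := hρ.hasRem hQ.monic hd
  have hQφ := hQ.natDegree_le hφ
  by_cases hQt : ν Q = ⊤
  -- Polynomials of degree less than deg φ are units or zero, so none of them other than 0 has
  -- infinite value. Applied to Q and then to Q - φ, this gives φ = Q.
  · have hdeg : φ.natDegree = Q.natDegree := by
      refine le_antisymm ?_ hQφ
      by_contra hlt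
      exact (hφ.unit_of_lt Q hQ.monic.ne_zero (degree_lt_degree (not_le.1 hlt))).ne_top hQt
    have hdeg' : φ.degree = Q.degree := by
      rw [degree_eq_natDegree hφ.monic.ne_zero, degree_eq_natDegree hQ.monic.ne_zero, hdeg]
    have ha : (Q - φ).degree < φ.degree := by
      rw [hdeg']
      exact degree_sub_lt_left hdeg'.symm hQ.monic.ne_zero (by rw [hQ.monic, hφ.monic])
    have h1 := hφ.hasRem (Q - φ) 1 ha
    rw [mul_one, sub_add_cancel, hQt, top_le_iff] at h1
    have h2 : Q - φ = 0 := by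
      by_contra h0
      exact (hφ.unit_of_lt _ h0 ha).ne_top h1
    rw [sub_eq_zero] at h2
    subst h2
    exact ⟨1, by simp, fun _ => rfl, by simp⟩
  have hρC : Extends v ρ := fun a => by
    rw [hρ.eq_of_lt (degree_C_le.trans_lt hd), hμ]
  have hw : Extends v (residueVal ν φ hφ) := fun a => by
    rw [← hμ a, val_C_eq hle, ← val_C_eq (le_residueVal hφ)]
  have hlow := nsmul_le_nsmul_val hv hw hφ.irreducible hφ.monic (residueVal_eq_top_iff hφ) hρC hrem
    hQ.monic hd' (hρQ ▸ hQt) (hρQ ▸ le_residueVal hφ Q)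
  have hup := hrem.nsmul_val_le hQ.monic hφ.monic
  have heq := le_antisymm hup hlow
  obtain ⟨γ, hγ⟩ := WithTop.ne_top_iff_exists.1 hQt
  rw [hρQ, ← hγ, ← WithTop.coe_nsmul] at heq
  have hφt : ρ φ ≠ ⊤ := by
    intro h
    rw [h] at heq
    obtain ⟨n, hn⟩ := Nat.exists_eq_succ_of_ne_zero hd'.ne'
    rw [hn, succ_nsmul, WithTop.add_top] at heq
    exact WithTop.top_ne_coe heq
  obtain ⟨x, hx⟩ := WithTop.ne_top_iff_exists.1 hφt
  rw [← hx, ← WithTop.coe_nsmul, WithTop.coe_inj] at heq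
  -- With this s, the quotient c of φ by Q ^ s is monic of degree less than deg Q: it is the leading
  -- coefficient of the Q-expansion.
  set s := φ.natDegree / Q.natDegree with hs
  have hQs : (Q ^ s).Monic := hQ.monic.pow s
  have hQsd : (Q ^ s).natDegree ≤ φ.natDegree := by
    rw [hQ.monic.natDegree_pow]; exact Nat.div_mul_le_self _ _
  have hcm : (φ /ₘ Q ^ s).Monic := by
    rw [Monic, leadingCoeff_divByMonic_of_monic hQs, hφ.monic]
    rw [degree_eq_natDegree hQs.ne_zero, degree_eq_natDegree hφ.monic.ne_zero]
    exact_mod_cast hQsd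
  have hcd : (φ /ₘ Q ^ s).natDegree = φ.natDegree % Q.natDegree := by
    rw [natDegree_divByMonic _ hQs, hQ.monic.natDegree_pow, hs, Nat.mod_eq_sub, mul_comm]
  have hgd := degree_modByMonic_lt φ hQs
  have hφe : φ /ₘ Q ^ s * Q ^ s + φ %ₘ Q ^ s = φ := by
    rw [mul_comm, add_comm]; exact modByMonic_add_div φ _
  have hsum := Nat.div_add_mod φ.natDegree Q.natDegree
  rw [← hs, ← hcd] at hsum
  set c := φ /ₘ Q ^ s
  have hbound := hrem.val_add_le hQ.monic s (c := c) hgd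
  have hclt : c.degree < Q.degree :=
    degree_lt_degree (by rw [hcd]; exact Nat.mod_lt _ hd')
  rw [hφe, ρ.map_mul, ρ.map_pow, hρ.eq_of_lt hclt, hρQ, ← hγ, ← hx, ← WithTop.coe_nsmul] at hbound
  -- The exact value of φ forces deg Q · μ(c) ≥ deg c · γ, while the general bound for μ gives deg Q
  -- · μ(c) ≤ deg c · μ(Q), and μ(Q) < γ.
  have hc0 : c.natDegree = 0 := by
    by_contra hc0
    have h1 := (hQ.hasRem hle).nsmul_val_le hQ.monic hcm
    obtain ⟨δ, hδ⟩ := WithTop.ne_top_iff_exists.1 hQ.lt.ne_top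
    have hct : μ c ≠ ⊤ := by
      rw [hQ.eq_of_lt c hclt]
      exact fun h => (hQ.initUnit c hcm.ne_zero hclt).ne_top h
    obtain ⟨y, hy⟩ := WithTop.ne_top_iff_exists.1 hct
    have hlt := hQ.lt
    rw [← hδ, ← hγ, WithTop.coe_lt_coe] at hlt
    rw [← hδ, ← hy, ← WithTop.coe_nsmul, ← WithTop.coe_nsmul, WithTop.coe_le_coe] at h1
    rw [← hy, ← WithTop.coe_add, WithTop.coe_le_coe] at hbound
    have h2 := nsmul_le_nsmul_right hbound Q.natDegree
    rw [heq, ← hsum, nsmul_add, add_comm, add_nsmul, mul_nsmul', add_le_add_iff_right] at h2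
    exact absurd (h2.trans h1) (not_le.2 (nsmul_lt_nsmul_right hc0 hlt))
  have hc1 : c = 1 := eq_one_of_monic_natDegree_zero hcm hc0
  rw [hc0, add_zero] at hsum
  refine ⟨s, by rw [← hsum, mul_comm], fun h => absurd h hφt, ?_⟩
  rw [← hx, hρQ, ← hγ, ← WithTop.coe_nsmul, WithTop.coe_inj]
  rw [hc1, μ.map_one, zero_add, WithTop.coe_le_coe] at hbound
  refine le_antisymm hbound ?_
  rw [← hsum, mul_comm, mul_nsmul] at heq
  exact le_of_nsmul_le_nsmul_right hd'.ne' heq.ge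

end Henselian

/-! ### Divisibility of initial forms and the identification of key polynomials. -/

section GradedForms

variable {K Λ : Type*} [Field K] [AddCommGroup Λ] [LinearOrder Λ] [IsOrderedAddMonoid Λ]
variable {μ ν ρ : AddValuation K[X] (WithTop Λ)} {Q φ ψ : K[X]}

theorem exists_valueGroup {f : K[X]} (h : μ f ≠ ⊤) :
    ∃ α : valueGroup μ, μ f = ((α : Λ) : WithTop Λ) :=
  ⟨⟨_, untop_mem_valueGroup μ f h⟩, (WithTop.coe_untop _ h).symm⟩

theorem initialForm_of_top {f : K[X]} (h : μ f = ⊤) : initialForm μ f = 0 := by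
  rw [initialForm, dif_pos h]

theorem of_pieceMk_congr {α β : valueGroup μ} (h : α = β) {f : levelGE μ α} {g : levelGE μ β}
    (hfg : (f : K[X]) = g) :
    DirectSum.of (GradedPiece μ) α (pieceMk α f) = DirectSum.of (GradedPiece μ) β (pieceMk β g) :=
  DirectSum.of_eq_of_gradedMonoid_eq (graded_mk_eq h hfg)

theorem initialForm_eq_of {f : K[X]} {α : valueGroup μ} (h : μ f = ((α : Λ) : WithTop Λ)) :
    initialForm μ f = DirectSum.of (GradedPiece μ) α (pieceMk α ⟨f, h.ge⟩) := by
  have ht : μ f ≠ ⊤ := by rw [h]; exact WithTop.coe_ne_top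
  rw [initialForm, dif_neg ht]
  refine of_pieceMk_congr (Subtype.ext ?_) rfl
  rw [← WithTop.coe_inj, WithTop.coe_untop, h]

theorem pieceMk_eq_zero_iff {α : valueGroup μ} {f : levelGE μ α} :
    pieceMk α f = 0 ↔ ((α : Λ) : WithTop Λ) < μ (f : K[X]) := by
  have h0 : pieceMk α (0 : levelGE μ α) = 0 := rfl
  rw [← h0, pieceMk_eq_iff]
  simp

theorem initialForm_mul (f g : K[X]) :
    initialForm μ (f * g) = initialForm μ f * initialForm μ g := by
  by_cases hf : μ f = ⊤
  · rw [initialForm_of_top hf, zero_mul, initialForm_of_top (by simp [hf])]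
  by_cases hg : μ g = ⊤
  · rw [initialForm_of_top hg, mul_zero, initialForm_of_top (by simp [hg])]
  obtain ⟨α, hα⟩ := exists_valueGroup hf
  obtain ⟨β, hβ⟩ := exists_valueGroup hg
  have h : μ (f * g) = (((α + β : valueGroup μ) : Λ) : WithTop Λ) := by
    rw [μ.map_mul, hα, hβ]; rfl
  rw [initialForm_eq_of hα, initialForm_eq_of hβ, initialForm_eq_of h, DirectSum.of_mul_of]
  rfl

theorem initialForm_one : initialForm μ 1 = 1 := by
  rw [initialForm_eq_of (α := 0) (by rw [μ.map_one]; rfl)]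
  rfl

theorem initialForm_pow (f : K[X]) (n : ℕ) : initialForm μ (f ^ n) = initialForm μ f ^ n := by
  induction n with
  | zero => rw [pow_zero, pow_zero, initialForm_one]
  | succ n ih => rw [pow_succ, pow_succ, initialForm_mul, ih]

theorem initialForm_eq_zero_iff {f : K[X]} : initialForm μ f = 0 ↔ μ f = ⊤ := by
  refine ⟨fun h => ?_, initialForm_of_top⟩
  by_contra hf
  obtain ⟨α, hα⟩ := exists_valueGroup hf
  rw [initialForm_eq_of hα] at h
  have h2 := congrArg (fun u : GradedAlgebra μ => u α) h
  simp only [DirectSum.of_eq_same, DirectSum.zero_apply] at h2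
  rw [pieceMk_eq_zero_iff] at h2
  exact h2.ne' hα

instance : Nontrivial (GradedAlgebra μ) :=
  ⟨initialForm μ 1, 0, by rw [Ne, initialForm_eq_zero_iff]; simp⟩

theorem initialForm_eq_of_lt {f g : K[X]} (h : μ f < μ (f - g)) :
    initialForm μ f = initialForm μ g := by
  obtain ⟨α, hα⟩ := exists_valueGroup h.ne_top
  have hg : μ g = μ f := by
    rw [μ.map_sub_swap] at h; exact μ.map_eq_of_lt_sub h
  rw [initialForm_eq_of hα, initialForm_eq_of (hg.trans hα)]
  congr 1
  exact pieceMk_eq_iff.2 (hα.ge.trans_lt h)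

theorem mul_of_apply (u : GradedAlgebra μ) (α : valueGroup μ) {β : valueGroup μ}
    (b : GradedPiece μ β) :
    (u * DirectSum.of (GradedPiece μ) β b) (α + β) = pieceMul (u α) b := by
  induction u using DirectSum.induction_on with
  | zero =>
    rw [zero_mul, DirectSum.zero_apply, DirectSum.zero_apply]
    obtain ⟨g, rfl⟩ := pieceMk_surjective b
    have h0 : (0 : GradedPiece μ α) = pieceMk α 0 := rfl
    rw [h0, pieceMul_mk, eq_comm, pieceMk_eq_zero_iff]
    simp
  | of α' a =>
    rw [DirectSum.of_mul_of]
    by_cases h : α' = α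
    · subst h
      rw [DirectSum.of_eq_same, DirectSum.of_eq_same]
      rfl
    · rw [DirectSum.of_eq_of_ne _ _ _ (by simpa [eq_comm] using h),
        DirectSum.of_eq_of_ne _ _ _ (Ne.symm h)]
      obtain ⟨g, rfl⟩ := pieceMk_surjective b
      have h0 : (0 : GradedPiece μ α) = pieceMk α 0 := rfl
      rw [h0, pieceMul_mk, eq_comm, pieceMk_eq_zero_iff]
      simp
  | add u u' hu hu' =>
    rw [add_mul, DirectSum.add_apply, hu, hu', DirectSum.add_apply, add_pieceMul]

theorem mul_initialForm_apply {u : GradedAlgebra μ} {α β δ : valueGroup μ} (hδ : α + β = δ)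
    {c : levelGE μ α} (hu : u α = pieceMk α c) {h : K[X]} (hh : μ h = ((β : Λ) : WithTop Λ))
    (hmem : (c : K[X]) * h ∈ levelGE μ δ) :
    (u * initialForm μ h) δ = pieceMk δ ⟨c * h, hmem⟩ := by
  subst hδ
  rw [initialForm_eq_of hh, mul_of_apply, hu, pieceMul_mk]

/-- Only the homogeneous component of the cofactor in degree μ(f) - μ(h) contributes, and it is the
class of a polynomial. -/
theorem initialForm_dvd_iff {h f : K[X]} (hf : μ f ≠ ⊤) :
    initialForm μ h ∣ initialForm μ f ↔ ∃ g, μ f < μ (f - h * g) := by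
  constructor
  · rintro ⟨u, hu⟩
    have hh : μ h ≠ ⊤ := by
      intro hh
      rw [initialForm_of_top hh, zero_mul, initialForm_eq_zero_iff] at hu
      exact hf hu
    obtain ⟨α, hα⟩ := exists_valueGroup hh
    obtain ⟨δ, hδ⟩ := exists_valueGroup hf
    obtain ⟨g, hg⟩ := pieceMk_surjective (u (δ - α))
    have hmem : (g : K[X]) * h ∈ levelGE μ δ := by
      have := mul_mem_levelGE g (⟨h, hα.ge⟩ : levelGE μ α)
      rwa [sub_add_cancel] at this
    have h1 := mul_initialForm_apply (sub_add_cancel δ α) hg.symm hα hmem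
    rw [mul_comm, ← hu, initialForm_eq_of hδ, DirectSum.of_eq_same, pieceMk_eq_iff] at h1
    exact ⟨g, by rw [hδ, mul_comm]; exact h1⟩
  · rintro ⟨g, hg⟩
    exact ⟨initialForm μ g, by rw [initialForm_eq_of_lt hg, initialForm_mul]⟩

theorem isUnit_initialForm_iff {f : K[X]} : IsUnit (initialForm μ f) ↔ InitUnit μ f := by
  rw [isUnit_iff_dvd_one, ← initialForm_one, initialForm_dvd_iff (by simp)]
  simp [InitUnit]

/-- A multiple of Q gains value under ν. Conversely, if the remainder of f had value μ(f), it would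
be a polynomial of degree less than deg Q with ν-value above its μ-value. Irreducibility of Q in the
graded algebra follows, since values add under products. -/
theorem Separates.initialForm_dvd_iff (h : Separates μ ν Q) (hle : ∀ f, μ f ≤ ν f) {f : K[X]}
    (hf : μ f ≠ ⊤) : initialForm μ Q ∣ initialForm μ f ↔ μ f < ν f := by
  rw [MLV.initialForm_dvd_iff hf]
  constructor
  · rintro ⟨g, hg⟩
    have h1 : μ f ≤ μ (Q * g) := by
      have := μ.map_le_sub le_rfl hg.le
      rwa [sub_sub_cancel] at this
    have := ν.map_lt_add (hg.trans_le (hle _)) (h.lt_val_mul hle h1 hf)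
    rwa [sub_add_cancel] at this
  · intro hlt
    refine ⟨f /ₘ Q, ?_⟩
    have hr := degree_modByMonic_lt f h.monic
    have he := modByMonic_add_div f Q
    have e : f - Q * (f /ₘ Q) = f %ₘ Q := by rw [sub_eq_iff_eq_add]; exact he.symm
    have h1 : μ f ≤ μ (f %ₘ Q) := by
      conv_lhs => rw [← he]
      exact h.hasRem hle _ _ hr
    have h2 : μ f ≤ μ (Q * (f /ₘ Q)) := by
      conv_lhs => rw [← he]
      exact (h.hasRem hle).val_le_mul hr
    rw [e]
    refine lt_of_le_of_ne h1 fun heq => ?_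
    have h3 := ν.map_lt_add (x := f) (y := -(Q * (f /ₘ Q))) hlt
      (by rw [ν.map_neg]; exact h.lt_val_mul hle h2 hf)
    rw [← sub_eq_add_neg, e, ← h.eq_of_lt _ hr] at h3
    exact h3.ne heq

theorem Separates.isKeyPolynomial (h : Separates μ ν Q) (hle : ∀ f, μ f ≤ ν f) :
    IsKeyPolynomial μ Q where
  monic := h.monic
  not_mem_supp := h.lt.ne_top
  not_isUnit := by
    rw [isUnit_iff_dvd_one, ← initialForm_one, h.initialForm_dvd_iff hle (by simp)]
    simp
  irreducible := by
    intro f g hfg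
    by_cases hf : μ f = ⊤
    · exact .inl (by rw [initialForm_of_top hf]; exact dvd_zero _)
    by_cases hg : μ g = ⊤
    · exact .inr (by rw [initialForm_of_top hg]; exact dvd_zero _)
    rw [h.initialForm_dvd_iff hle (by rw [μ.map_mul]; simp [hf, hg]), μ.map_mul, ν.map_mul] at hfg
    rw [h.initialForm_dvd_iff hle hf, h.initialForm_dvd_iff hle hg]
    by_contra! hcon
    exact absurd hfg (not_lt.2 (add_le_add hcon.1 hcon.2))
  minimal := by
    intro f hf0 hf
    by_contra hlt
    rw [not_le] at hlt
    have hd := degree_lt_degree hlt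
    have hft : μ f ≠ ⊤ := by
      rw [h.eq_of_lt f hd]; exact (h.initUnit f hf0 hd).ne_top
    rw [h.initialForm_dvd_iff hle hft] at hf
    exact hf.ne (h.eq_of_lt f hd)

/-- When ν(φ) is finite, φ itself separates ν from the valuation with support φ. -/
theorem IsMinNonunit.isKeyPolynomial (h : IsMinNonunit ν φ) (ht : ν φ ≠ ⊤) :
    IsKeyPolynomial ν φ :=
  Separates.isKeyPolynomial (ν := residueVal ν φ h)
    ⟨h.monic, by rw [(residueVal_eq_top_iff h φ).2 dvd_rfl]; exact lt_top_iff_ne_top.2 ht,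
      fun a ha => by rw [residueVal_apply, (modByMonic_eq_self_iff h.monic).2 ha]⟩
    (le_residueVal h)

theorem IsMinNonunit.natDegree_eq (h : IsMinNonunit ν φ) (h' : IsMinNonunit ν ψ) :
    φ.natDegree = ψ.natDegree := by
  refine le_antisymm ?_ ?_
  · by_contra hlt
    exact h'.not_unit (h.unit_of_lt ψ h'.monic.ne_zero (degree_lt_degree (not_le.1 hlt)))
  · by_contra hlt
    exact h.not_unit (h'.unit_of_lt φ h.monic.ne_zero (degree_lt_degree (not_le.1 hlt)))

theorem IsMinimalKeyPolynomial.isMinNonunit (h : IsMinimalKeyPolynomial ν φ) :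
    IsMinNonunit ν φ := by
  have hnu : ¬ InitUnit ν φ := fun hu => h.1.not_isUnit (isUnit_initialForm_iff.2 hu)
  obtain ⟨ψ, hψ⟩ := exists_isMinNonunit h.1.monic.ne_zero hnu
  by_cases hψt : ν ψ = ⊤
  -- If a minimal nonunit ψ lay in the support, φ would have the same initial form as its remainder
  -- modulo ψ, which is a unit.
  · exfalso
    have hr := degree_modByMonic_lt φ hψ.monic
    have he := modByMonic_add_div φ ψ
    have e : φ - φ %ₘ ψ = ψ * (φ /ₘ ψ) := by rw [sub_eq_iff_eq_add, add_comm]; exact he.symm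
    have ht : ν (φ - φ %ₘ ψ) = ⊤ := by rw [e]; simp [hψt]
    have hr0 : φ %ₘ ψ ≠ 0 := by
      intro h0
      rw [h0, sub_zero] at ht
      exact h.1.not_mem_supp ht
    have hru := hψ.unit_of_lt _ hr0 hr
    exact hnu (hru.of_lt (by rw [ht]; exact lt_top_iff_ne_top.2 hru.ne_top))
  · have hdeg := h.2 ψ (hψ.isKeyPolynomial hψt)
    exact ⟨h.1.monic, hnu, fun a ha hlt =>
      hψ.unit_of_lt a ha (degree_lt_degree ((natDegree_lt_natDegree ha hlt).trans_le hdeg))⟩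

theorem isMinNonunit_iff :
    IsMinNonunit ν φ ↔ IsMinimalKeyPolynomial ν φ ∨ IsSupportGenerator ν φ := by
  constructor
  · intro h
    by_cases ht : ν φ = ⊤
    · refine .inr ⟨h.monic, h.irreducible, ?_⟩
      ext f
      rw [AddValuation.mem_supp_iff, Ideal.mem_span_singleton]
      refine ⟨fun hf => ?_, fun ⟨c, hc⟩ => by rw [hc]; simp [ht]⟩
      rw [← residueVal_eq_top_iff h]
      exact top_le_iff.1 (hf ▸ le_residueVal h f)
    · refine .inl ⟨h.isKeyPolynomial ht, fun ψ hψ => ?_⟩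
      by_contra hlt
      exact hψ.not_isUnit (isUnit_initialForm_iff.2
        (h.unit_of_lt ψ hψ.monic.ne_zero (degree_lt_degree (not_le.1 hlt))))
  · rintro (h | ⟨hm, hirr, hs⟩)
    · exact h.isMinNonunit
    · have hmem : ∀ f, ν f = ⊤ ↔ φ ∣ f := fun f => by
        rw [← AddValuation.mem_supp_iff, hs, Ideal.mem_span_singleton]
      have ht : ν φ = ⊤ := (hmem φ).2 dvd_rfl
      refine ⟨hm, fun hu => hu.ne_top ht, fun a ha hlt => ?_⟩
      obtain ⟨b, hb⟩ := exists_inverse_mod hirr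
        (fun hd => absurd (degree_le_of_dvd hd ha) (not_le.2 hlt))
      refine ⟨b, ?_⟩
      rw [ν.map_sub_swap, (hmem _).2 hb]
      exact WithTop.coe_lt_top 0

theorem IsMinNonunit.valDegree_eq (h : IsMinNonunit ν φ) : valDegree ν = φ.natDegree := by
  have : {n | ∃ ψ : K[X], (IsMinimalKeyPolynomial ν ψ ∨ IsSupportGenerator ν ψ) ∧
      ψ.natDegree = n} = {φ.natDegree} := by
    ext n
    simp only [Set.mem_ofPred_eq, Set.mem_singleton_iff, ← isMinNonunit_iff]
    exact ⟨fun ⟨ψ, hψ, hn⟩ => hn ▸ hψ.natDegree_eq h, fun hn => ⟨φ, h, hn.symm⟩⟩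
  rw [valDegree, this, csInf_singleton]

end GradedForms

/-! ### Lexicographic enlargement of the value group by an infinitesimal. -/

section Lex

variable (Λ : Type*) [AddCommGroup Λ]

/-- The embedding `a ↦ (a, 0)` of `Λ ∪ {∞}` into `(Λ × ℤ) ∪ {∞}`. -/
def lexInl : WithTop Λ →+ WithTop (Λ ×ₗ ℤ) :=
  AddMonoidHom.withTopMap
    { toFun := fun a => toLex (a, 0)
      map_zero' := rfl
      map_add' := fun _ _ => rfl }

/-- The projection `(a, n) ↦ a` of `(Λ × ℤ) ∪ {∞}` onto `Λ ∪ {∞}`. -/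
def lexFst : WithTop (Λ ×ₗ ℤ) →+ WithTop Λ :=
  AddMonoidHom.withTopMap
    { toFun := fun a => (ofLex a).1
      map_zero' := rfl
      map_add' := fun _ _ => rfl }

variable {Λ}

theorem lexInl_coe (a : Λ) : lexInl Λ a = ((toLex (a, 0) : Λ ×ₗ ℤ) : WithTop (Λ ×ₗ ℤ)) := rfl

theorem lexInl_top : lexInl Λ ⊤ = ⊤ := rfl

theorem lexFst_coe (a : Λ) (n : ℤ) :
    lexFst Λ ((toLex (a, n) : Λ ×ₗ ℤ) : WithTop (Λ ×ₗ ℤ)) = a := rfl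

theorem lexFst_top : lexFst Λ ⊤ = ⊤ := rfl

theorem lexFst_lexInl (x : WithTop Λ) : lexFst Λ (lexInl Λ x) = x := by
  induction x with
  | top => rfl
  | coe a => rfl

variable [LinearOrder Λ]

theorem lexInl_mono : Monotone (lexInl Λ) := by
  refine Monotone.withTop_map fun a b h => ?_
  change (toLex (a, 0) : Λ ×ₗ ℤ) ≤ toLex (b, 0)
  rw [Prod.Lex.toLex_le_toLex]
  exact (lt_or_eq_of_le h).imp_right fun h => ⟨h, le_rfl⟩

theorem lexFst_mono : Monotone (lexFst Λ) :=
  Monotone.withTop_map fun a b h => Prod.Lex.monotone_fst a b h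

theorem lexInl_min (x y : WithTop Λ) :
    lexInl Λ (min x y) = min (lexInl Λ x) (lexInl Λ y) := by
  rcases le_total x y with h | h
  · rw [min_eq_left h, min_eq_left (lexInl_mono h)]
  · rw [min_eq_right h, min_eq_right (lexInl_mono h)]

theorem lexFst_min (x y : WithTop (Λ ×ₗ ℤ)) :
    lexFst Λ (min x y) = min (lexFst Λ x) (lexFst Λ y) := by
  rcases le_total x y with h | h
  · rw [min_eq_left h, min_eq_left (lexFst_mono h)]
  · rw [min_eq_right h, min_eq_right (lexFst_mono h)]

end Lex

/-! ### Homogeneous units and the subalgebra they generate. -/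

section Units

variable {K Λ : Type*} [Field K] [AddCommGroup Λ] [LinearOrder Λ] [IsOrderedAddMonoid Λ]
variable {μ ν ρ : AddValuation K[X] (WithTop Λ)} {Q φ ψ : K[X]}

/-- A polynomial with unit initial form has the same initial form as its remainder. -/
theorem InitUnit.lt_val_mul (hsep : Separates μ ρ ψ) (hle : ∀ f, μ f ≤ ρ f) (hrem : HasRem ρ ψ)
    {f : K[X]} (hf : InitUnit ρ f) : ρ f < ρ (ψ * (f /ₘ ψ)) := by
  by_cases ht : ρ ψ = ⊤
  · rw [ρ.map_mul, ht, WithTop.top_add]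
    exact lt_top_iff_ne_top.2 hf.ne_top
  obtain ⟨γ, hγ⟩ := WithTop.ne_top_iff_exists.1 ht
  have hm := hsep.monic
  have hd := hsep.degree_pos
  set μ' : AddValuation K[X] (WithTop (Λ ×ₗ ℤ)) := μ.map (lexInl Λ) lexInl_top lexInl_mono with hμ'
  -- Lower the value of ψ infinitesimally. The resulting ρ' projects to ρ, and ρ'(f) falls strictly
  -- below ρ(f) as soon as a term divisible by ψ attains the minimum.
  set γ' : WithTop (Λ ×ₗ ℤ) := ((toLex (γ, -1) : Λ ×ₗ ℤ) : WithTop (Λ ×ₗ ℤ)) with hγ'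
  have hγle : μ' ψ ≤ γ' := by
    obtain ⟨δ, hδ⟩ := WithTop.ne_top_iff_exists.1 hsep.lt.ne_top
    have hlt := hsep.lt
    rw [← hδ, ← hγ, WithTop.coe_lt_coe] at hlt
    rw [hμ', AddValuation.map_apply, ← hδ, lexInl_coe, hγ', WithTop.coe_le_coe,
      Prod.Lex.toLex_le_toLex]
    exact .inl hlt
  have hmul : ∀ a b r c : K[X], a.degree < ψ.degree → b.degree < ψ.degree →
      r.degree < ψ.degree → a * b = r + ψ * c → μ' r = μ' a + μ' b := by
    intro a b r c ha hb hr e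
    rw [hμ', AddValuation.map_apply, AddValuation.map_apply, AddValuation.map_apply, ← map_add,
      hsep.val_remainder hle ha hb hr e]
  let ρ' := augment μ' ψ γ' hm hd hmul hγle
  have hadd : ∀ a q : K[X], a.degree < ψ.degree →
      ρ' (a + ψ * q) = min (lexInl Λ (ρ a)) (γ' + ρ' q) := by
    intro a q ha
    rw [← hsep.eq_of_lt a ha]
    exact truncation_add hm hd ha q
  have hfst : ∀ f, lexFst Λ (ρ' f) = ρ f := by
    refine induction_divByMonic hm hd (by rw [ρ'.map_zero, ρ.map_zero, lexFst_top]) ?_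
    intro a q ha ih
    rw [hadd a q ha, lexFst_min, map_add, ih, lexFst_lexInl, hγ', lexFst_coe, hγ,
      hrem.val_add_eq ha]
  have hγ1 : γ' < lexInl Λ γ := by
    rw [lexInl_coe, hγ', WithTop.coe_lt_coe, Prod.Lex.toLex_lt_toLex]
    exact .inr ⟨rfl, by norm_num⟩
  have hinl : ∀ f, ρ' f ≤ lexInl Λ (ρ f) := by
    refine induction_divByMonic hm hd (by rw [ρ.map_zero, lexInl_top]; exact le_top) ?_
    intro a q ha ih
    rw [hadd a q ha, hrem.val_add_eq ha, lexInl_min, map_add, ← hγ]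
    exact min_le_min le_rfl (add_le_add hγ1.le ih)
  have hr := degree_modByMonic_lt f hm
  have he := modByMonic_add_div f ψ
  have h1 : ρ f ≤ ρ (ψ * (f /ₘ ψ)) := by
    conv_lhs => rw [← he]
    exact hrem.val_le_mul hr
  refine lt_of_le_of_ne h1 fun heq => ?_
  obtain ⟨g, hg⟩ := hf
  have h0 : ρ f + ρ g = 0 := by rw [← ρ.map_mul]; exact val_eq_zero_of_pos hg
  have h2 : ρ' f < lexInl Λ (ρ f) := by
    have h3 : ρ' f ≤ γ' + ρ' (f /ₘ ψ) := by
      conv_lhs => rw [← he]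
      rw [hadd _ _ hr]
      exact min_le_right _ _
    have hqt : ρ (f /ₘ ψ) ≠ ⊤ := by
      intro h
      rw [ρ.map_mul, h, WithTop.add_top] at heq
      exact InitUnit.ne_top ⟨g, hg⟩ heq
    have hqt' : lexInl Λ (ρ (f /ₘ ψ)) ≠ ⊤ := by
      obtain ⟨a, ha⟩ := WithTop.ne_top_iff_exists.1 hqt
      rw [← ha, lexInl_coe]
      exact WithTop.coe_ne_top
    rw [heq, ρ.map_mul, map_add, ← hγ]
    exact (h3.trans (add_le_add_right (hinl _) _)).trans_lt (WithTop.add_lt_add_right hqt' hγ1)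
  have h3 : 0 < ρ' (1 - f * g) := by
    by_contra hn
    have := lexFst_mono (not_lt.1 hn)
    rw [hfst, map_zero] at this
    exact absurd hg (not_lt.2 this)
  -- An inverse for ρ is also an inverse for ρ'. Both sums of values are then 0, which the strict
  -- drop at f together with ρ'(g) ≤ ρ(g) contradicts.
  have h4 : ρ' f + ρ' g = 0 := by rw [← ρ'.map_mul]; exact val_eq_zero_of_pos h3
  have hgt : ρ' g ≠ ⊤ := by
    intro h
    rw [h, WithTop.add_top] at h4
    exact WithTop.top_ne_zero h4
  have h5 := (WithTop.add_lt_add_right hgt h2).trans_le (add_le_add_right (hinl g) _)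
  rw [h4, ← map_add, h0, map_zero] at h5
  exact h5.false

/-- The homogeneous components of the elements of `𝒢_ρ⁰` are classes of polynomials of degree less
than the degree of `ψ`. -/
theorem unitSubalgebra_apply (hsep : Separates μ ρ ψ) (hle : ∀ f, μ f ≤ ρ f) (hrem : HasRem ρ ψ)
    {x : GradedAlgebra ρ} (hx : x ∈ unitSubalgebra ρ) (α : valueGroup ρ) :
    ∃ c : levelGE ρ α, (c : K[X]).degree < ψ.degree ∧ x α = pieceMk α c := by
  have h0 : (0 : K[X]).degree < ψ.degree := degree_zero_lt hsep.monic
  rw [unitSubalgebra, Subring.mem_closure_iff] at hx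
  induction hx using AddSubgroup.closure_induction with
  | zero => exact ⟨0, h0, rfl⟩
  | add x y _ _ hx hy =>
    obtain ⟨c, hc, hxc⟩ := hx
    obtain ⟨d, hd, hyd⟩ := hy
    exact ⟨c + d, (degree_add_le _ _).trans_lt (max_lt hc hd), by
      rw [DirectSum.add_apply, hxc, hyd, pieceMk_add]⟩
  | neg x _ hx =>
    obtain ⟨c, hc, hxc⟩ := hx
    refine ⟨-c, by rwa [AddSubgroup.coe_neg, degree_neg], ?_⟩
    have : (-x) α = -(x α) := DFinsupp.neg_apply x α
    rw [this, hxc]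
    rfl
  | mem x hx =>
    -- Products of homogeneous units are homogeneous units, so every element of the subalgebra is an
    -- integral combination of such units.
    have hx' : IsUnit x ∧ ∃ (β : valueGroup ρ) (a : GradedPiece ρ β),
        x = DirectSum.of (GradedPiece ρ) β a := by
      induction hx using Submonoid.closure_induction with
      | mem x hx => exact hx
      | one => exact ⟨isUnit_one, 0, _, rfl⟩
      | mul x y _ _ hx hy =>
        obtain ⟨hxu, β, a, rfl⟩ := hx
        obtain ⟨hyu, β', a', rfl⟩ := hy
        exact ⟨hxu.mul hyu, β + β', _, DirectSum.of_mul_of a a'⟩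
    obtain ⟨hu, β, a, rfl⟩ := hx'
    by_cases hαβ : β = α
    · subst hαβ
      obtain ⟨f, rfl⟩ := pieceMk_surjective a
      have hf : ρ (f : K[X]) = ((β : Λ) : WithTop Λ) := by
        refine le_antisymm ?_ f.2
        by_contra hlt
        rw [pieceMk_eq_zero_iff.2 (not_le.1 hlt), map_zero] at hu
        exact not_isUnit_zero hu
      have hin := initialForm_eq_of hf
      rw [← show initialForm ρ (f : K[X]) = DirectSum.of (GradedPiece ρ) β (pieceMk β f) from hin,
        isUnit_initialForm_iff] at hu
      have hlt := hu.lt_val_mul hsep hle hrem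
      have he := modByMonic_add_div (f : K[X]) ψ
      have hsub : (f : K[X]) - f %ₘ ψ = ψ * (f /ₘ ψ) := by
        rw [sub_eq_iff_eq_add, add_comm]; exact he.symm
      have hr : ((β : Λ) : WithTop Λ) ≤ ρ ((f : K[X]) %ₘ ψ) := by
        have e : (f : K[X]) %ₘ ψ = f - ψ * (f /ₘ ψ) := by rw [← hsub, sub_sub_cancel]
        rw [e, ← hf]
        exact ρ.map_le_sub le_rfl hlt.le
      refine ⟨⟨_, hr⟩, degree_modByMonic_lt _ hsep.monic, ?_⟩
      rw [DirectSum.of_eq_same, pieceMk_eq_iff]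
      change _ < ρ ((f : K[X]) - f %ₘ ψ)
      rw [hsub, ← hf]
      exact hlt
    · refine ⟨0, h0, ?_⟩
      rw [DirectSum.of_eq_of_ne _ _ _ (Ne.symm hαβ)]
      rfl

end Units

/-! ### The degree of an initial form as a polynomial in the initial form of ψ. -/

section RelativeDegree

variable {K Λ : Type*} [Field K] [AddCommGroup Λ] [LinearOrder Λ] [IsOrderedAddMonoid Λ]
variable {μ ν ρ : AddValuation K[X] (WithTop Λ)} {Q φ ψ : K[X]}

theorem degree_mul_pow_lt (hψ : ψ.Monic) {c : K[X]} (hc : c.degree < ψ.degree) (n : ℕ) :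
    (c * ψ ^ n).degree < (ψ ^ (n + 1)).degree := by
  by_cases h0 : c = 0
  · rw [h0, zero_mul]
    exact degree_zero_lt (hψ.pow _)
  · refine degree_lt_degree ?_
    rw [natDegree_mul h0 (hψ.pow n).ne_zero, hψ.natDegree_pow, hψ.natDegree_pow]
    have := natDegree_lt_natDegree h0 hc
    linarith

theorem degree_pow_le_succ (hψ : ψ.Monic) (n : ℕ) : (ψ ^ n).degree ≤ (ψ ^ (n + 1)).degree := by
  rw [pow_succ, degree_mul]
  exact le_add_of_nonneg_right (zero_le_degree_iff.2 hψ.ne_zero)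

theorem degree_sum_expansion_lt (hψ : ψ.Monic) {c : ℕ → K[X]}
    (hc : ∀ i, (c i).degree < ψ.degree) (n : ℕ) :
    (∑ i ∈ Finset.range n, c i * ψ ^ i).degree < (ψ ^ n).degree := by
  induction n with
  | zero =>
    rw [Finset.sum_range_zero]
    exact degree_zero_lt (hψ.pow 0)
  | succ n ih =>
    rw [Finset.sum_range_succ]
    exact (degree_add_le _ _).trans_lt
      (max_lt (ih.trans_le (degree_pow_le_succ hψ n)) (degree_mul_pow_lt hψ (hc n) n))

theorem exists_expansion_of_degree_lt (hψ : ψ.Monic) {s : ℕ} {g : K[X]}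
    (hg : g.degree < (ψ ^ s).degree) :
    ∃ a : ℕ → K[X], (∀ i, (a i).degree < ψ.degree) ∧ g = ∑ i ∈ Finset.range s, a i * ψ ^ i := by
  induction s generalizing g with
  | zero =>
    refine ⟨0, fun _ => degree_zero_lt hψ, ?_⟩
    rw [pow_zero, degree_one] at hg
    by_contra h0
    exact absurd hg (not_lt.2 (zero_le_degree_iff.2 (by simpa using h0)))
  | succ s ih =>
    obtain ⟨c, hc, hce⟩ := ih (degree_divByMonic_pow_lt hψ hg)
    refine ⟨consSeq (g %ₘ ψ) c, degree_consSeq_lt (degree_modByMonic_lt g hψ) hc, ?_⟩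
    rw [sum_consSeq, ← hce, modByMonic_add_div]

theorem sum_mul_pow_apply {γ : valueGroup ρ} (hγ : ρ ψ = ((γ : Λ) : WithTop Λ))
    {u : ℕ → GradedAlgebra ρ} {δ : valueGroup ρ} (c : ∀ i : ℕ, levelGE ρ (δ - i • γ))
    (hu : ∀ i, u i (δ - i • γ) = pieceMk _ (c i)) (n : ℕ) :
    ∃ hmem : ∑ i ∈ Finset.range n, (c i : K[X]) * ψ ^ i ∈ levelGE ρ δ,
      (∑ i ∈ Finset.range n, u i * initialForm ρ ψ ^ i) δ = pieceMk δ ⟨_, hmem⟩ := by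
  induction n with
  | zero => exact ⟨zero_mem _, rfl⟩
  | succ n ih =>
    obtain ⟨h1, h2⟩ := ih
    have hn : ρ (ψ ^ n) = (((n • γ : valueGroup ρ) : Λ) : WithTop Λ) := by
      rw [ρ.map_pow, hγ, ← WithTop.coe_nsmul]; rfl
    have h3 : (c n : K[X]) * ψ ^ n ∈ levelGE ρ δ := by
      have := mul_mem_levelGE (c n) (⟨ψ ^ n, hn.ge⟩ : levelGE ρ (n • γ))
      rwa [sub_add_cancel] at this
    have h4 := mul_initialForm_apply (sub_add_cancel δ (n • γ)) (hu n) hn h3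
    rw [initialForm_pow] at h4
    refine ⟨by rw [Finset.sum_range_succ]; exact add_mem h1 h3, ?_⟩
    rw [Finset.sum_range_succ, DirectSum.add_apply, h2, h4, ← pieceMk_add]
    congr 1
    exact Subtype.ext (Finset.sum_range_succ _ _).symm

theorem aeval_initialForm (p : (unitSubalgebra ρ)[X]) :
    aeval (initialForm ρ ψ) p = ∑ i ∈ Finset.range (p.natDegree + 1),
      (p.coeff i : GradedAlgebra ρ) * initialForm ρ ψ ^ i := by
  rw [aeval_eq_sum_range]
  rfl

/-- The component of degree `δ` of an initial form is the class of `f` or zero. -/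
theorem initialForm_apply {f : K[X]} (hf : ρ f ≠ ⊤) (δ : valueGroup ρ) :
    ∃ f' : levelGE ρ δ, ((f' : K[X]) = f ∨ (f' : K[X]) = 0) ∧
      initialForm ρ f δ = pieceMk δ f' := by
  obtain ⟨α, hα⟩ := exists_valueGroup hf
  rw [initialForm_eq_of hα]
  by_cases h : α = δ
  · subst h
    exact ⟨⟨f, hα.ge⟩, .inl rfl, DirectSum.of_eq_same _ _⟩
  · exact ⟨0, .inr rfl, DirectSum.of_eq_of_ne _ _ _ (Ne.symm h)⟩

theorem natDegree_of_aeval_eq (hsep : Separates μ ρ ψ) (hle : ∀ f, μ f ≤ ρ f)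
    (hrem : HasRem ρ ψ) {f g : K[X]} {s : ℕ} (hψt : ρ ψ ≠ ⊤) (hft : ρ f ≠ ⊤)
    (hfs : ρ f = s • ρ ψ) (hfe : f = ψ ^ s + g) (hg : g.degree < (ψ ^ s).degree)
    {p : (unitSubalgebra ρ)[X]} (hp : aeval (initialForm ρ ψ) p = initialForm ρ f) :
    p.natDegree = s := by
  have hm := hsep.monic
  obtain ⟨γ, hγ⟩ := exists_valueGroup hψt
  have key : ∀ δ : valueGroup ρ, ∃ c : ∀ i : ℕ, levelGE ρ (δ - i • γ),
      (∀ i, (c i : K[X]).degree < ψ.degree) ∧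
      (∀ i, (p.coeff i : GradedAlgebra ρ) (δ - i • γ) = pieceMk _ (c i)) ∧
      ∀ f' : levelGE ρ δ, initialForm ρ f δ = pieceMk δ f' → ((δ : Λ) : WithTop Λ) <
        ρ (∑ i ∈ Finset.range (p.natDegree + 1), (c i : K[X]) * ψ ^ i - f') := by
    intro δ
    have hex : ∀ i : ℕ, ∃ c : levelGE ρ (δ - i • γ), (c : K[X]).degree < ψ.degree ∧
        (p.coeff i : GradedAlgebra ρ) (δ - i • γ) = pieceMk (δ - i • γ) c := fun i =>
      unitSubalgebra_apply hsep hle hrem (p.coeff i).2 (δ - i • γ)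
    choose c hcd hc using hex
    refine ⟨c, hcd, hc, fun f' hf' => ?_⟩
    obtain ⟨hmem, h1⟩ := sum_mul_pow_apply hγ c hc (p.natDegree + 1)
    rw [← aeval_initialForm, hp, hf', eq_comm, pieceMk_eq_iff] at h1
    exact h1
  refine le_antisymm ?_ ?_
  -- If deg p > s, take a degree where the leading coefficient of p has a nonzero component c_d. The
  -- term c_d ψ^d then dominates in degree, so its value must exceed δ, which makes that component
  -- zero.
  · by_contra hlt
    rw [not_le] at hlt
    have hp0 : p ≠ 0 := by rintro rfl; simp at hlt
    have hlc : (p.coeff p.natDegree : GradedAlgebra ρ) ≠ 0 := by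
      rw [Ne, ZeroMemClass.coe_eq_zero]
      exact leadingCoeff_ne_zero.2 hp0
    obtain ⟨α, hα⟩ : ∃ α, (p.coeff p.natDegree : GradedAlgebra ρ) α ≠ 0 := by
      by_contra! h
      exact hlc (DFinsupp.ext h)
    set d := p.natDegree with hd
    obtain ⟨δ, rfl⟩ : ∃ δ, α = δ - d • γ := ⟨α + d • γ, by rw [add_sub_cancel_right]⟩
    obtain ⟨c, hcd, hc, hcf⟩ := key δ
    obtain ⟨f', hf', hf'e⟩ := initialForm_apply hft δ
    have h1 := hcf f' hf'e
    have hfd : (f' : K[X]).degree < (ψ ^ d).degree := by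
      rcases hf' with h | h
      · rw [h, hfe]
        refine degree_lt_degree ?_
        rw [natDegree_add_eq_left_of_degree_lt hg, hm.natDegree_pow, hm.natDegree_pow]
        exact Nat.mul_lt_mul_of_pos_right hlt hsep.natDegree_pos
      · rw [h]
        exact degree_zero_lt (hm.pow d)
    rw [Finset.sum_range_succ, add_comm, add_sub_assoc] at h1
    have h2 := h1.trans_le (hrem.val_add_le hm d
      ((degree_sub_le _ _).trans_lt (max_lt (degree_sum_expansion_lt hm hcd d) hfd)))
    rw [hc d, Ne, pieceMk_eq_zero_iff] at hα
    refine hα ?_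
    by_contra hle'
    rw [not_lt] at hle'
    rw [ρ.map_mul, ρ.map_pow, hγ, ← WithTop.coe_nsmul] at h2
    have h3 := h2.trans_le (add_le_add_left hle' _)
    rw [← WithTop.coe_add, WithTop.coe_lt_coe] at h3
    simp at h3
  -- If deg p < s, then ψ^s stays the leading term of the difference, whose value cannot exceed
  -- ρ(ψ^s) = ρ(f).
  · by_contra hlt
    rw [not_le] at hlt
    obtain ⟨δ, hδ⟩ := exists_valueGroup hft
    obtain ⟨c, hcd, hc, hcf⟩ := key δ
    have h1 := hcf ⟨f, hδ.ge⟩ (by rw [initialForm_eq_of hδ, DirectSum.of_eq_same])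
    change _ < ρ (_ - f) at h1
    rw [ρ.map_sub_swap, hfe, add_sub_assoc, ← hδ, hfs, ← ρ.map_pow] at h1
    have hsum := degree_sum_expansion_lt hm hcd (p.natDegree + 1)
    have hpow : (ψ ^ (p.natDegree + 1)).degree ≤ (ψ ^ s).degree := by
      rw [degree_eq_natDegree (hm.pow _).ne_zero, degree_eq_natDegree (hm.pow _).ne_zero,
        hm.natDegree_pow, hm.natDegree_pow]
      exact_mod_cast Nat.mul_le_mul_right _ hlt
    have h2 := hrem.val_add_le hm s (c := 1)
      ((degree_sub_le _ _).trans_lt (max_lt hg (hsum.trans_le hpow)))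
    rw [one_mul] at h2
    exact absurd h1 (not_lt.2 h2)

theorem exists_aeval_eq (hsep : Separates μ ρ ψ) (hrem : HasRem ρ ψ) {f g : K[X]} {s : ℕ}
    (hft : ρ f ≠ ⊤) (hfs : ρ f = s • ρ ψ) (hfe : f = ψ ^ s + g)
    (hg : g.degree < (ψ ^ s).degree) :
    ∃ p : (unitSubalgebra ρ)[X], aeval (initialForm ρ ψ) p = initialForm ρ f := by
  have hm := hsep.monic
  obtain ⟨a, ha, hga⟩ := exists_expansion_of_degree_lt hm hg
  obtain ⟨δ, hδ⟩ := exists_valueGroup hft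
  have hψs : ρ (ψ ^ s) = ((δ : Λ) : WithTop Λ) := by rw [ρ.map_pow, ← hfs, hδ]
  have hterm : ∀ i ∈ Finset.range s, ((δ : Λ) : WithTop Λ) ≤ ρ (a i * ψ ^ i) := by
    intro i hi
    have hgl : ((δ : Λ) : WithTop Λ) ≤ ρ g := by
      have : g = f - ψ ^ s := by rw [hfe, add_sub_cancel_left]
      rw [this]
      exact ρ.map_le_sub hδ.ge hψs.ge
    rw [hga, hrem.val_sum s a ha] at hgl
    rw [ρ.map_mul, ρ.map_pow]
    exact hgl.trans (Finset.inf_le hi)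
  -- Terms of value exactly δ get the unit initial form of their coefficient; terms of larger value
  -- vanish in degree δ and get coefficient 0.
  have hcoef : ∀ i ∈ Finset.range s, ∃ c : unitSubalgebra ρ, ∀ hmem : a i * ψ ^ i ∈ levelGE ρ δ,
      (c : GradedAlgebra ρ) * initialForm ρ ψ ^ i =
        DirectSum.of (GradedPiece ρ) δ (pieceMk δ ⟨_, hmem⟩) := by
    intro i hi
    by_cases heq : ρ (a i * ψ ^ i) = ((δ : Λ) : WithTop Λ)
    · have hai : a i ≠ 0 := by
        intro h
        rw [h, zero_mul, ρ.map_zero] at heq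
        exact WithTop.top_ne_coe heq
      have hu := hsep.initUnit (a i) hai (ha i)
      obtain ⟨β, hβ⟩ := exists_valueGroup hu.ne_top
      refine ⟨⟨initialForm ρ (a i), Subring.subset_closure
        ⟨isUnit_initialForm_iff.2 hu, β, _, initialForm_eq_of hβ⟩⟩, fun hmem => ?_⟩
      rw [← initialForm_pow, ← initialForm_mul, initialForm_eq_of heq]
    · refine ⟨0, fun hmem => ?_⟩
      rw [pieceMk_eq_zero_iff.2 (lt_of_le_of_ne (hterm i hi) (Ne.symm heq)), map_zero]
      simp
  choose! c hc using hcoef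
  have hsum : ∀ n ≤ s, ∃ hmem : ∑ i ∈ Finset.range n, a i * ψ ^ i ∈ levelGE ρ δ,
      DirectSum.of (GradedPiece ρ) δ (pieceMk δ ⟨_, hmem⟩) =
        ∑ i ∈ Finset.range n, (c i : GradedAlgebra ρ) * initialForm ρ ψ ^ i := by
    intro n hn
    induction n with
    | zero => exact ⟨zero_mem _, map_zero _⟩
    | succ n ih =>
      obtain ⟨h1, h2⟩ := ih (by omega)
      have hns : n ∈ Finset.range s := Finset.mem_range.2 (by omega)
      have h3 : a n * ψ ^ n ∈ levelGE ρ δ := hterm n hns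
      refine ⟨by rw [Finset.sum_range_succ]; exact add_mem h1 h3, ?_⟩
      refine Eq.trans ?_ (Finset.sum_range_succ _ n).symm
      rw [hc n hns h3, ← h2, ← map_add, ← pieceMk_add]
      congr 2
      exact Subtype.ext (Finset.sum_range_succ _ _)
  obtain ⟨h1, h2⟩ := hsum s le_rfl
  refine ⟨X ^ s + ∑ i ∈ Finset.range s, C (c i) * X ^ i, ?_⟩
  have h3 : aeval (initialForm ρ ψ) (∑ i ∈ Finset.range s, C (c i) * X ^ i) =
      ∑ i ∈ Finset.range s, (c i : GradedAlgebra ρ) * initialForm ρ ψ ^ i := by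
    rw [map_sum]
    refine Finset.sum_congr rfl fun i _ => ?_
    rw [map_mul, aeval_C, map_pow, aeval_X]
    rfl
  rw [map_add, map_pow, aeval_X, h3, ← h2, ← initialForm_pow, initialForm_eq_of hψs,
    initialForm_eq_of hδ, ← map_add, ← pieceMk_add]
  congr 2
  refine Subtype.ext ?_
  change ψ ^ s + ∑ i ∈ Finset.range s, a i * ψ ^ i = f
  rw [← hga, ← hfe]

/-- `muDegree` allows any minimal key polynomial of ρ, so Q must be replaceable by ψ. The two have
equal degree, and neither can cancel against their difference, which forces equal values. -/
theorem Separates.of_isMinNonunit (h : Separates μ ρ Q) (hrem : HasRem ρ Q)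
    (hψ : IsMinNonunit ρ ψ) : Separates μ ρ ψ ∧ ρ ψ = ρ Q := by
  have hQ : IsMinNonunit ρ Q := ⟨h.monic, hrem.not_initUnit h.degree_pos, h.initUnit⟩
  have hnd := hψ.natDegree_eq hQ
  have hdeg : ψ.degree = Q.degree := by
    rw [degree_eq_natDegree hψ.monic.ne_zero, degree_eq_natDegree h.monic.ne_zero, hnd]
  have ha : (ψ - Q).degree < Q.degree := by
    rw [← hdeg]
    exact degree_sub_lt_left hdeg hψ.monic.ne_zero (by rw [h.monic, hψ.monic])
  have h1 := hrem (ψ - Q) 1 ha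
  rw [mul_one, sub_add_cancel] at h1
  have h2 := hψ.hasRem (-(ψ - Q)) 1 (by rw [degree_neg, hdeg]; exact ha)
  rw [mul_one, ρ.map_neg, neg_sub, sub_add_cancel] at h2
  have h3 : ρ ψ ≤ ρ Q := by
    have := ρ.map_le_sub le_rfl h1
    rwa [sub_sub_cancel] at this
  have h4 : ρ Q ≤ ρ ψ := by
    have := ρ.map_le_add le_rfl h2
    rwa [add_sub_cancel] at this
  have heq := le_antisymm h3 h4
  refine ⟨⟨hψ.monic, ?_, fun a ha => h.eq_of_lt a (hdeg ▸ ha)⟩, heq⟩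
  have h5 : μ Q < μ (ψ - Q) := by
    rw [h.eq_of_lt _ ha]
    exact h.lt.trans_le h2
  rw [heq, μ.map_eq_of_lt_sub h5]
  exact h.lt

/-- The relative degree of a monic polynomial `f` of degree `s deg Q` and value `s ρ(Q)`. -/
theorem muDegree_eq (hsep : Separates μ ρ Q) (hle : ∀ f, μ f ≤ ρ f) (hrem : HasRem ρ Q)
    {f : K[X]} {s : ℕ} (hQt : ρ Q ≠ ⊤) (hf : f.Monic) (hfd : f.natDegree = s * Q.natDegree)
    (hft : ρ f ≠ ⊤) (hfs : ρ f = s • ρ Q) : muDegree ρ f = s := by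
  have hQ : IsMinNonunit ρ Q := ⟨hsep.monic, hrem.not_initUnit hsep.degree_pos, hsep.initUnit⟩
  have hex : ∀ ψ : K[X], ψ.Monic → ψ.natDegree = Q.natDegree →
      ∃ g, f = ψ ^ s + g ∧ g.degree < (ψ ^ s).degree := by
    intro ψ hψ hd
    have hdeg : f.degree = (ψ ^ s).degree := by
      rw [degree_eq_natDegree hf.ne_zero, degree_eq_natDegree (hψ.pow s).ne_zero,
        hψ.natDegree_pow, hd, hfd]
    refine ⟨f - ψ ^ s, by ring, ?_⟩
    rw [← hdeg]
    exact degree_sub_lt_left hdeg hf.ne_zero (by rw [hf, hψ.pow s])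
  have hset : {n | ∃ ψ : K[X], IsMinimalKeyPolynomial ρ ψ ∧ ∃ p : (unitSubalgebra ρ)[X],
      aeval (initialForm ρ ψ) p = initialForm ρ f ∧ p.natDegree = n} = {s} := by
    have hall : ∀ ψ : K[X], IsMinimalKeyPolynomial ρ ψ → ∀ p : (unitSubalgebra ρ)[X],
        aeval (initialForm ρ ψ) p = initialForm ρ f → p.natDegree = s := by
      intro ψ hψ p hp
      have hψ' := hψ.isMinNonunit
      obtain ⟨hs, hv⟩ := hsep.of_isMinNonunit hrem hψ'
      obtain ⟨g, hfe, hg⟩ := hex ψ hs.monic (hψ'.natDegree_eq hQ)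
      exact natDegree_of_aeval_eq hs hle hψ'.hasRem (hv ▸ hQt) hft (hv ▸ hfs) hfe hg hp
    ext n
    rw [Set.mem_ofPred_eq, Set.mem_singleton_iff]
    constructor
    · rintro ⟨ψ, hψ, p, hp, rfl⟩
      exact hall ψ hψ p hp
    · rintro rfl
      have hQk : IsMinimalKeyPolynomial ρ Q :=
        (isMinNonunit_iff.1 hQ).resolve_right fun h =>
          hQt ((AddValuation.mem_supp_iff ρ Q).1 (h.2.2 ▸ Ideal.mem_span_singleton_self Q))
      obtain ⟨g, hfe, hg⟩ := hex Q hsep.monic rfl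
      obtain ⟨p, hp⟩ := exists_aeval_eq hsep hrem hft hfs hfe hg
      exact ⟨Q, hQk, p, hp, hall Q hQk p hp⟩
  rw [muDegree, hset, csInf_singleton]

end RelativeDegree

/-! ### The defect formula, and its application to both kinds of augmentation. -/

section Defect

variable {K Λ : Type*} [Field K] [AddCommGroup Λ] [LinearOrder Λ] [IsOrderedAddMonoid Λ]
variable {v : AddValuation K (WithTop Λ)} {μ ν ρ : AddValuation K[X] (WithTop Λ)} {Q φ : K[X]}
variable {γ : WithTop Λ}

theorem ActsOnExpansions.le (h : ActsOnExpansions μ Q γ ρ) (hrem : HasRem μ Q) (hQ : Q.Monic)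
    (hd : 0 < Q.degree) (hγ : μ Q ≤ γ) : ∀ f, μ f ≤ ρ f := by
  refine induction_divByMonic hQ hd (by simp) fun a q ha ih => ?_
  rw [hrem.val_add_eq ha, (h.hasRem hQ hd).val_add_eq ha, h.eq_of_lt ha, h.val_eq hd]
  exact min_le_min le_rfl (add_le_add hγ ih)

open Classical in
/-- Over a henselian field, the relative degree of `φ` over `[μ; Q, ν(Q)]` is `deg φ / deg Q` for
each `Q` in the tangent direction. -/
theorem Separates.relativeDegree_mul (hv : IsHenselian v) (hμ : Extends v μ)
    (hle : ∀ f, μ f ≤ ν f) (hQ : Separates μ ν Q) (hφ : IsMinNonunit ν φ)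
    (hρ : ActsOnExpansions μ Q (ν Q) ρ) :
    (if ρ φ = ⊤ then 1 else muDegree ρ φ) * Q.natDegree = φ.natDegree := by
  obtain ⟨s, hs, hs1, hsv⟩ := hQ.exists_natDegree_eq hv hμ hle hφ hρ
  have hd := hQ.degree_pos
  split_ifs with ht
  · rw [hs, hs1 ht]
  · have hsep : Separates μ ρ Q :=
      ⟨hQ.monic, by rw [hρ.val_eq hd]; exact hQ.lt, fun a ha => (hρ.eq_of_lt ha).symm⟩
    -- Here s is positive because φ is nonconstant, so an infinite ρ(Q) would make ρ(φ) infinite.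
    have hQt : ρ Q ≠ ⊤ := by
      intro h
      have hs0 : s ≠ 0 := by
        rintro rfl
        have := natDegree_pos_iff_degree_pos.2 hφ.degree_pos
        omega
      obtain ⟨n, rfl⟩ := Nat.exists_eq_succ_of_ne_zero hs0
      rw [h, succ_nsmul, WithTop.add_top] at hsv
      exact ht hsv
    rw [muDegree_eq hsep (hρ.le (hQ.hasRem hle) hQ.monic hd hQ.lt.le) (hρ.hasRem hQ.monic hd) hQt
      hφ.monic hs ht hsv, hs]

/-- The defect formula for an arbitrary pair `μ < ν`. -/
theorem exists_isDefect (hv : IsHenselian v) (hμ : Extends v μ) (hle : ∀ f, μ f ≤ ν f)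
    (hne : μ ≠ ν) (hφ : IsMinNonunit ν φ) :
    ∃ d : ℕ, IsDefect μ ν d ∧ (d : ℚ) = (valDegree ν : ℚ) / (tangentDegree μ ν : ℚ) := by
  obtain ⟨Q, hQt⟩ := tangent_nonempty hle hne
  have hQ := (mem_tangent_iff hle).1 hQt
  obtain ⟨ρ, hρ⟩ := hQ.exists_augmentation hle
  obtain ⟨d, hmul⟩ : ∃ d, d * Q.natDegree = φ.natDegree :=
    ⟨_, hQ.relativeDegree_mul hv hμ hle hφ hρ⟩
  have hpos := hQ.natDegree_pos
  refine ⟨d, ⟨⟨φ, isMinNonunit_iff.1 hφ⟩, fun ψ hψ => ?_⟩, ?_⟩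
  rotate_left
  · rw [hφ.valDegree_eq, tangentDegree_eq hQt, ← hmul, Nat.cast_mul, mul_div_assoc, div_self,
      mul_one]
    exact_mod_cast hpos.ne'
  · have hψ' := isMinNonunit_iff.2 hψ
    constructor
    · refine ⟨Q, hQt, ρ, ⟨hQ.isKeyPolynomial hle, hQ.lt, hρ⟩, ?_⟩
      refine Nat.eq_of_mul_eq_mul_right hpos ?_
      rw [hmul, hQ.relativeDegree_mul hv hμ hle hψ' hρ, hφ.natDegree_eq hψ']
    -- Any other P in the tangent direction has the same degree as Q, hence gives the same relative
    -- degree.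
    · rintro n ⟨P, hPt, ρ', hρ', rfl⟩
      have hP := (mem_tangent_iff hle).1 hPt
      refine le_of_eq (Nat.eq_of_mul_eq_mul_right hpos ?_)
      rw [hmul, ← tangentDegree_eq hQt, tangentDegree_eq hPt,
        hP.relativeDegree_mul hv hμ hle hψ' hρ'.2.2, hφ.natDegree_eq hψ']

theorem IsKeyPolynomial.hasRem (h : IsKeyPolynomial μ φ) : HasRem μ φ := by
  intro a q ha
  by_contra hlt
  rw [not_le] at hlt
  have ha0 : a ≠ 0 := by rintro rfl; simp at hlt
  have hdvd : initialForm μ φ ∣ initialForm μ a :=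
    (initialForm_dvd_iff hlt.ne_top).2 ⟨-q, by rwa [mul_neg, sub_neg_eq_add]⟩
  exact absurd (natDegree_lt_natDegree ha0 ha) (not_lt.2 (h.minimal a ha0 hdvd))

theorem degree_pos_of_ne_one (hφ : φ.Monic) (h : φ ≠ 1) : 0 < φ.degree := by
  by_contra h0
  exact h (hφ.eq_one_of_isUnit (isUnit_iff_degree_eq_zero.2
    (le_antisymm (not_lt.1 h0) (zero_le_degree_iff.2 hφ.ne_zero))))

theorem IsKeyPolynomial.degree_pos (h : IsKeyPolynomial μ φ) : 0 < φ.degree := by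
  refine degree_pos_of_ne_one h.monic ?_
  rintro rfl
  exact h.not_isUnit (by rw [initialForm_one]; exact isUnit_one)

theorem ActsOnExpansions.exists_isMinNonunit {β : K[X] → WithTop Λ} (h : ActsOnExpansions β φ γ ν)
    (hφ : φ.Monic) (hd : 0 < φ.degree) : ∃ ψ, IsMinNonunit ν ψ :=
  MLV.exists_isMinNonunit hφ.ne_zero ((h.hasRem hφ hd).not_initUnit hd)

/-! ### Limit augmentations and families based on their first member. -/

section Limit

variable {A : Type*} [LinearOrder A] {ρ : A → AddValuation K[X] (WithTop Λ)}

theorem IsContinuousFamily.mono (h : IsContinuousFamily ρ) {i j : A} (hij : i ≤ j) (f : K[X]) :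
    ρ i f ≤ ρ j f := by
  rcases hij.eq_or_lt with rfl | hlt
  · rfl
  · exact h.le_of_lt i j hlt f

theorem IsLimitKeyPolynomial.isStable (h : IsLimitKeyPolynomial ρ φ) [Nonempty A] {a : K[X]}
    (ha : a.degree < φ.degree) : IsStable ρ a := by
  by_cases ha0 : a = 0
  · obtain ⟨i⟩ := ‹Nonempty A›
    exact ⟨i, fun j _ => by simp [ha0]⟩
  by_contra hs
  exact absurd (natDegree_lt_natDegree ha0 ha) (not_lt.2 (h.2.2 a hs))

theorem IsLimitKeyPolynomial.degree_pos (h : IsLimitKeyPolynomial ρ φ) [Nonempty A] :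
    0 < φ.degree := by
  refine degree_pos_of_ne_one h.1 ?_
  rintro rfl
  obtain ⟨i⟩ := ‹Nonempty A›
  exact h.2.1 ⟨i, fun j _ => by simp⟩

theorem exists_stableValue_eq {f : K[X]} (h : IsStable ρ f) :
    ∃ i, ∀ j, i ≤ j → stableValue ρ f = ρ j f := by
  refine ⟨h.choose, fun j hj => ?_⟩
  rw [stableValue, dif_pos h, h.choose_spec j hj]

theorem IsLimitAugmentation.exists_le [Nonempty A] (h : IsLimitAugmentation ρ φ γ ν) (f : K[X]) :
    ∃ i, ∀ j, i ≤ j → ρ j f ≤ ν f := by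
  obtain ⟨hC, hφ, hγ, hν⟩ := h
  have hd := hφ.degree_pos
  refine induction_divByMonic hφ.1 hd (P := fun f => ∃ i, ∀ j, i ≤ j → ρ j f ≤ ν f) ?_ ?_ f
  · obtain ⟨i⟩ := ‹Nonempty A›
    exact ⟨i, fun j _ => by simp⟩
  rintro a q ha ⟨i₁, hi₁⟩
  obtain ⟨i₀, hi₀⟩ := exists_stableValue_eq (hφ.isStable ha)
  rw [← hν.eq_of_lt ha] at hi₀
  -- If a cancelled against φq from some stage on, the value of φq would be constant there; as the
  -- values of φ and q can only grow, φ would be stable.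
  have hrem : ∀ j, i₀ ≤ j → ρ j (a + φ * q) ≤ ρ j a := by
    intro j hj
    by_contra hlt
    rw [not_le] at hlt
    have hconst : ∀ k, j ≤ k → ρ k (φ * q) = ρ j a := by
      intro k hk
      have hak : ρ k a = ρ j a := by rw [← hi₀ k (hj.trans hk), ← hi₀ j hj]
      have e : φ * q = (a + φ * q) - a := by ring
      rw [e, (ρ k).map_sub_eq_of_lt_right, hak]
      rw [hak]
      exact hlt.trans_le (hC.mono hk _)
    refine hφ.2.1 ⟨j, fun k hk => ?_⟩
    by_contra hne
    have hφlt := lt_of_le_of_ne (hC.mono hk φ) (Ne.symm hne)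
    have h1 := hconst j le_rfl
    have h2 := hconst k hk
    rw [AddValuation.map_mul] at h1 h2
    have hqt : ρ j q ≠ ⊤ := by
      intro ht
      rw [ht, WithTop.add_top] at h1
      exact hlt.ne_top h1.symm
    have := WithTop.add_lt_add_of_lt_of_le hqt hφlt (hC.mono hk q)
    rw [h1, h2] at this
    exact this.false
  refine ⟨max i₀ i₁, fun j hj => ?_⟩
  have hj₀ := (le_max_left _ _).trans hj
  have hj₁ := (le_max_right _ _).trans hj
  have h1 := hrem j hj₀
  refine ν.map_le_add (h1.trans (hi₀ j hj₀).ge) ?_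
  have h2 := (ρ j).map_le_sub le_rfl h1
  rw [add_sub_cancel_left] at h2
  refine h2.trans ?_
  rw [AddValuation.map_mul, AddValuation.map_mul, hν.val_eq hd]
  exact add_le_add (hγ j).le (hi₁ j hj₁)

theorem IsLimitAugmentation.le (h : IsLimitAugmentation ρ φ γ ν) (i : A) (f : K[X]) :
    ρ i f ≤ ν f := by
  have : Nonempty A := ⟨i⟩
  obtain ⟨j, hj⟩ := h.exists_le f
  exact (h.1.mono (le_max_left i j) f).trans (hj _ (le_max_right i j))

theorem IsLimitAugmentation.ne (h : IsLimitAugmentation ρ φ γ ν) (i : A) : ρ i ≠ ν := by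
  have : Nonempty A := ⟨i⟩
  intro he
  have := h.2.2.1 i
  rw [he, h.2.2.2.val_eq h.2.1.degree_pos] at this
  exact this.false

/-- For a continuous family based on `μ`, the tangent direction has degree `deg(μ)`. -/
theorem IsLimitAugmentation.tangentDegree_eq [OrderBot A] [NoMaxOrder A]
    (h : IsLimitAugmentation ρ φ γ ν) (hb : IsBased ρ) :
    tangentDegree (ρ ⊥) ν = valDegree (ρ ⊥) := by
  have hle := h.le ⊥
  obtain ⟨Q, hQt⟩ := tangent_nonempty hle (h.ne ⊥)
  rw [MLV.tangentDegree_eq hQt]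
  have nonunit : ∀ {μ ν : AddValuation K[X] (WithTop Λ)} {P : K[X]}, (∀ f, μ f ≤ ν f) →
      Separates μ ν P → ¬ InitUnit μ P := fun hle hP hu =>
    (hP.isKeyPolynomial hle).not_isUnit (isUnit_initialForm_iff.2 hu)
  refine le_antisymm ?_ ?_
  · obtain ⟨i₀, hi₀⟩ := hb
    obtain ⟨j, hj⟩ := exists_gt i₀
    obtain ⟨k, hk⟩ := exists_gt j
    have hbj : (⊥ : A) < j := bot_le.trans_lt hj
    -- The next member ρ k serves only to produce a nonunit for ρ j, and with it a minimal one
    -- computing deg(ρ j).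
    obtain ⟨P, hP⟩ := tangent_nonempty (h.1.le_of_lt j k hk) (h.1.ne_of_lt j k hk)
    have hP' := (mem_tangent_iff (h.1.le_of_lt j k hk)).1 hP
    obtain ⟨ψ, hψ⟩ := exists_isMinNonunit hP'.monic.ne_zero
      (nonunit (h.1.le_of_lt j k hk) hP')
    rw [← hi₀ j hj.le, hψ.valDegree_eq]
    obtain ⟨R, hR⟩ := tangent_nonempty (h.1.le_of_lt ⊥ j hbj) (h.1.ne_of_lt ⊥ j hbj)
    have hR' := (mem_tangent_iff (h.1.le_of_lt ⊥ j hbj)).1 hR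
    -- A polynomial separating the first member from ρ j also separates it from ν, so deg t(μ, ν) ≤
    -- deg t(μ, ρ j) ≤ deg(ρ j) = deg(μ).
    exact (hQt.2.2 R hR.1 (hR.2.1.trans_le (h.le j R))).trans (hR'.natDegree_le hψ)
  -- Conversely Q is not a unit for the first member, so its degree is at least that of a minimal
  -- nonunit.
  · have hQ := (mem_tangent_iff hle).1 hQt
    obtain ⟨ψ, hψ⟩ := exists_isMinNonunit hQ.monic.ne_zero (nonunit hle hQ)
    rw [hψ.valDegree_eq]
    by_contra hlt
    exact nonunit hle hQ (hψ.unit_of_lt Q hQ.monic.ne_zero (degree_lt_degree (not_le.1 hlt)))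

theorem IsLimitAugmentation.exists_isDefect [OrderBot A] (hv : IsHenselian v)
    (hμ : Extends v (ρ ⊥)) (h : IsLimitAugmentation ρ φ γ ν) :
    ∃ d : ℕ, IsDefect (ρ ⊥) ν d ∧ (d : ℚ) = (valDegree ν : ℚ) / (tangentDegree (ρ ⊥) ν : ℚ) := by
  obtain ⟨ψ, hψ⟩ := h.2.2.2.exists_isMinNonunit h.2.1.1 h.2.1.degree_pos
  exact MLV.exists_isDefect hv hμ (h.le ⊥) (h.ne ⊥) hψ

end Limit

theorem IsOrdinaryAugmentation.exists_isDefect (hv : IsHenselian v) (hμ : Extends v μ)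
    (h : IsOrdinaryAugmentation μ φ γ ν) :
    ∃ d : ℕ, IsDefect μ ν d ∧ (d : ℚ) = (valDegree ν : ℚ) / (tangentDegree μ ν : ℚ) := by
  obtain ⟨hφ, hγ, hν⟩ := h
  have hd := hφ.degree_pos
  obtain ⟨ψ, hψ⟩ := hν.exists_isMinNonunit hφ.monic hd
  refine MLV.exists_isDefect hv hμ (hν.le hφ.hasRem hφ.monic hd hγ.le) ?_ hψ
  rintro rfl
  rw [hν.val_eq hd] at hγ
  exact hγ.false

end Defect

end MLV

end

theorem mainTheorem11 {K : Type u} {Λ : Type w} [Field K] [AddCommGroup Λ] [LinearOrder Λ]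
    [IsOrderedAddMonoid Λ] (v : AddValuation K (WithTop Λ)) (hv : MLV.IsHenselian v)
    (μ ν : AddValuation K[X] (WithTop Λ)) (hμ : MLV.Extends v μ) :
    (MLV.IsAugmentation.{u, w, z} μ ν →
      ∃ d : ℕ, MLV.IsDefect μ ν d ∧
        (d : ℚ) = (MLV.valDegree ν : ℚ) / (MLV.tangentDegree μ ν : ℚ)) ∧
    (∀ (A : Type z) [LinearOrder A] [WellFoundedLT A] [OrderBot A] [NoMaxOrder A]
        (ρ : A → AddValuation K[X] (WithTop Λ)) (φ : K[X]) (γ : WithTop Λ),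
      ρ ⊥ = μ → MLV.IsBased ρ → MLV.IsLimitAugmentation ρ φ γ ν →
      ∃ d : ℕ, MLV.IsDefect μ ν d ∧
        (d : ℚ) = (MLV.valDegree ν : ℚ) / (MLV.valDegree μ : ℚ)) := by
  constructor
  · rintro (⟨φ, γ, h⟩ | ⟨A, _, _, _, _, ρ, φ, γ, rfl, h⟩)
    · exact h.exists_isDefect hv hμ
    · exact h.exists_isDefect hv hμ
  · intro A _ _ _ _ ρ φ γ hρ hb h
    subst hρ
    rw [← h.tangentDegree_eq hb]
    exact h.exists_isDefect hv hμ
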